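/- Let $q$ be a complex number with $0<|q|<1$, fix a square root $q^{1/2}$ of $q$, and put $q^{e/2}:=(q^{1/2})^e$ for $e\in\mathbb{Z}$. Write $(a;p)_\infty=\prod_{j\ge0}(1-ap^j)$, $(a,b,c;p)_\infty=(a;p)_\infty(b;p)_\infty(c;p)_\infty$, $(a)_\infty=(a;q)_\infty$, $(a)_k=(a)_\infty/(aq^k)_\infty$ for $k\in\mathbb{Z}$, and $\left[{N\atop j}\right]=\frac{(q)_N}{(q)_j(q)_{N-j}}$ for $0\le j\le N$, $\left[{N\atop j}\right]=0$ for $j<0$ or $j>N$. Let $m\ge0$, $r\ge2$ and $0\le i\le r-1$ be integers. All sums below run over integers $s_1,s_2,\dots$ and converge absolutely. (1) One has $$\sum_{s_1\ge\dots\ge s_r\ge-\lfloor m/2\rfloor}\frac{q^{s_1^2+\dots+s_r^2+m(s_1+\dots+s_{r-1}+s_r/2)-s_1-\dots-s_i}(-q^{m/2})_{s_r}}{(q)_{s_1-s_2}\cdots(q)_{s_{r-1}-s_r}(-q^{1+m/2})_{s_{r-1}}}(-1)^{s_r}\left[{m+s_r\atop m+2s_r}\right]=b_m,$$ where, for every integer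 $n\ge0$, $$b_{2n}=\frac{1+q^n}{2(q)_\infty}\sum_{k=0}^{i}\sum_{\ell=0}^{2n}(-1)^\ell q^{2nk+n\ell}\bigl(q^{2r},q^{2nr+r-i-n+2k+\ell},q^{r+i-2nr+n-2k-\ell};q^{2r}\bigr)_\infty$$ and $$b_{2n+1}=(-1)^nq^{(1-r)n^2+(1+2i-2r)n/2}\,\frac{1+q^{(2n+1)/2}}{2(q)_\infty}\sum_{k=0}^i\sum_{\ell=0}^nq^{k+\ell}\Bigl(\bigl(q^{2r},q^{2r-i-n+2k+2\ell-1/2},q^{i+n-2k-2\ell+1/2};q^{2r}\bigr)_\infty-q^{1/2}\bigl(q^{2r},q^{2r-i-n+2k+2\ell+1/2},q^{i+n-2k-2\ell-1/2};q^{2r}\bigr)_\infty\Bigr).$$ (2) One has $$\sum_{s_1\ge\dots\ge s_r\ge-\lfloor m/2\rfloor}\frac{q^{s_1^2/2+s_2^2+\dots+s_r^2+m(s_1/2+s_2+\dots+s_r)+s_1/2-(s_1+\dots+s_i)}(-q^{m/2})_{s_1}}{(q)_{s_1-s_2}\cdots(q)_{s_{r-1}-s_r}}(-1)^{s_r}q^{\binom{s_r}{2}}\left[{m+s_r\atop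 m+2s_r}\right]=c_m,$$ where $\binom{s}{2}=s(s-1)/2$ and, for every integer $n\ge0$, $$c_{2n}=\frac{(-q^n)_\infty}{2(q)_\infty}\sum_{k=0}^{2i}\sum_{\ell=0}^{2n}(-1)^\ell q^{nk+n\ell}\bigl(q^{2r},q^{2nr+r-i-n+k+\ell},q^{r+i-2nr+n-k-\ell};q^{2r}\bigr)_\infty$$ and $$c_{2n+1}=(-1)^nq^{(1-r)n^2+(1+2i-2r)n/2}\,\frac{(-q^{(2n+1)/2})_\infty}{(q)_\infty}\sum_{\ell=0}^{n}q^{\ell}\bigl(q^{2r},q^{2r-i-n+2\ell-1/2},q^{i+n-2\ell+1/2};q^{2r}\bigr)_\infty.$$ (3) For all $q\in\mathbb{C}$ with $|q|<1$ (including $q=0$), $$\sum_{s_1\ge\dots\ge s_{r-1}\ge0}\frac{q^{s_1^2/2+s_2^2+\dots+s_{r-1}^2+s_1/2-(s_1+\dots+s_i)}(-1)_{s_1}}{(q)_{s_1-s_2}\cdots(q)_{s_{r-2}-s_{r-1}}(q)_{s_{r-1}}}=\frac{(-q)_\infty}{(q)_\infty}\sum_{k=0}^{2i}\bigl(q^{2r},q^{r-i+k},q^{r+i-k};q^{2r}\bigr)_\infty.$$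 -/

import Mathlib

open Finset

noncomputable section

/-- The infinite product `(a; p)_∞ = ∏_{j ≥ 0} (1 - a p^j)` (used only for `|p| < 1`). -/
def qInf (a p : ℂ) : ℂ := ∏' j : ℕ, (1 - a * p ^ j)

/-- `(a, b, c; p)_∞ = (a; p)_∞ (b; p)_∞ (c; p)_∞`. -/
def qInf3 (a b c p : ℂ) : ℂ := qInf a p * qInf b p * qInf c p

/-- `(a)_k = (a; q)_k = (a; q)_∞ / (a q^k; q)_∞` for every integer `k`. -/
def qPoch (a q : ℂ) (k : ℤ) : ℂ := qInf a q / qInf (a * q ^ k) q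

/-- The `q`-binomial coefficient: `(q)_N / ((q)_j (q)_{N-j})` for `0 ≤ j ≤ N`,
and `0` for `j < 0` and for `j > N`. -/
def qBinom (q : ℂ) (N j : ℤ) : ℂ :=
  if 0 ≤ j ∧ j ≤ N then qPoch q q N / (qPoch q q j * qPoch q q (N - j)) else 0

/-- Integer sequences `s_1 ≥ s_2 ≥ ⋯ ≥ s_n ≥ lo`. -/
def DecSeq (n : ℕ) (lo : ℤ) : Type :=
  {s : Fin n → ℤ // Antitone s ∧ ∀ j, lo ≤ s j}

/-- The entry `s_j`, in the numbering `s_1, …, s_n`; only used for `1 ≤ j ≤ n`. -/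
def DecSeq.entry {n : ℕ} {lo : ℤ} (s : DecSeq n lo) (j : ℕ) : ℤ :=
  if h : 1 ≤ j ∧ j ≤ n then s.1 ⟨j - 1, by omega⟩ else 0

/-- The summand of the `m`-version of Bressoud's (3.7). Here and below `t` is a square root
of `q`, so that `q^{e/2}` is written `t ^ e`. -/
def termB (q t : ℂ) (m r i : ℕ) (s : DecSeq r (-((m / 2 : ℕ) : ℤ))) : ℂ :=
  q ^ ((∑ j ∈ Icc 1 r, s.entry j ^ 2) + m * (∑ j ∈ Icc 1 (r - 1), s.entry j)
      - ∑ j ∈ Icc 1 i, s.entry j)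
    * t ^ ((m : ℤ) * s.entry r)
    * qPoch (-t ^ m) q (s.entry r)
    / ((∏ j ∈ Icc 1 (r - 1), qPoch q q (s.entry j - s.entry (j + 1)))
        * qPoch (-(q * t ^ m)) q (s.entry (r - 1)))
    * (-1) ^ (s.entry r)
    * qBinom q (m + s.entry r) (m + 2 * s.entry r)

/-- `b_{2m}`. -/
def bEven (q : ℂ) (m r i : ℕ) : ℂ :=
  (1 + q ^ m) / (2 * qInf q q)
    * ∑ k ∈ range (i + 1), ∑ l ∈ range (2 * m + 1),
        (-1) ^ l * q ^ (2 * m * k + m * l)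
          * qInf3 (q ^ (2 * r))
              (q ^ (2 * m * r + r - i - m + 2 * k + l : ℤ))
              (q ^ (r + i - 2 * m * r + m - 2 * k - l : ℤ))
              (q ^ (2 * r))

/-- `b_{2m+1}`. -/
def bOdd (q t : ℂ) (m r i : ℕ) : ℂ :=
  (-1) ^ m * t ^ (2 * (1 - r) * m ^ 2 + (1 + 2 * i - 2 * r) * m : ℤ)
    * ((1 + t ^ (2 * m + 1)) / (2 * qInf q q))
    * ∑ k ∈ range (i + 1), ∑ l ∈ range (m + 1),
        q ^ (k + l)
          * (qInf3 (q ^ (2 * r))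
                (t ^ (2 * (2 * r - i - m + 2 * k + 2 * l) - 1 : ℤ))
                (t ^ (2 * (i + m - 2 * k - 2 * l) + 1 : ℤ))
                (q ^ (2 * r))
              - t * qInf3 (q ^ (2 * r))
                (t ^ (2 * (2 * r - i - m + 2 * k + 2 * l) + 1 : ℤ))
                (t ^ (2 * (i + m - 2 * k - 2 * l) - 1 : ℤ))
                (q ^ (2 * r)))

/-- The summand of the `m`-version of Bressoud's (3.8). -/
def termC (q t : ℂ) (m r i : ℕ) (s : DecSeq r (-((m / 2 : ℕ) : ℤ))) : ℂ :=
  t ^ (s.entry 1 ^ 2 + m * s.entry 1 + s.entry 1)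
    * q ^ ((∑ j ∈ Icc 2 r, s.entry j ^ 2) + m * (∑ j ∈ Icc 2 r, s.entry j)
      - ∑ j ∈ Icc 1 i, s.entry j)
    * qPoch (-t ^ m) q (s.entry 1)
    / (∏ j ∈ Icc 1 (r - 1), qPoch q q (s.entry j - s.entry (j + 1)))
    * (-1) ^ (s.entry r)
    * q ^ (s.entry r * (s.entry r - 1) / 2)
    * qBinom q (m + s.entry r) (m + 2 * s.entry r)

/-- `c_{2m}`. -/
def cEven (q : ℂ) (m r i : ℕ) : ℂ :=
  qInf (-q ^ m) q / (2 * qInf q q)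
    * ∑ k ∈ range (2 * i + 1), ∑ l ∈ range (2 * m + 1),
        (-1) ^ l * q ^ (m * k + m * l)
          * qInf3 (q ^ (2 * r))
              (q ^ (2 * m * r + r - i - m + k + l : ℤ))
              (q ^ (r + i - 2 * m * r + m - k - l : ℤ))
              (q ^ (2 * r))

/-- `c_{2m+1}`. -/
def cOdd (q t : ℂ) (m r i : ℕ) : ℂ :=
  (-1) ^ m * t ^ (2 * (1 - r) * m ^ 2 + (1 + 2 * i - 2 * r) * m : ℤ)
    * (qInf (-t ^ (2 * m + 1)) q / qInf q q)
    * ∑ l ∈ range (m + 1),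
        q ^ l
          * qInf3 (q ^ (2 * r))
              (t ^ (2 * (2 * r - i - m + 2 * l) - 1 : ℤ))
              (t ^ (2 * (i + m - 2 * l) + 1 : ℤ))
              (q ^ (2 * r))

/-- `b_m`, split by the parity of `m`. -/
def bVal (q t : ℂ) (m r i : ℕ) : ℂ :=
  if Even m then bEven q (m / 2) r i else bOdd q t (m / 2) r i

/-- `c_m`, split by the parity of `m`. -/
def cVal (q t : ℂ) (m r i : ℕ) : ℂ :=
  if Even m then cEven q (m / 2) r i else cOdd q t (m / 2) r i

/-- The summand of the identity obtained from the `m`-version of (3.8) at `m = 0`;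
`s_1^2/2 + s_1/2` is the integer `s_1 (s_1 + 1) / 2`. -/
def termCor (q : ℂ) (r i : ℕ) (s : DecSeq (r - 1) 0) : ℂ :=
  q ^ (s.entry 1 * (s.entry 1 + 1) / 2 + (∑ j ∈ Icc 2 (r - 1), s.entry j ^ 2)
      - ∑ j ∈ Icc 1 i, s.entry j)
    * qPoch (-1) q (s.entry 1)
    / ((∏ j ∈ Icc 1 (r - 2), qPoch q q (s.entry j - s.entry (j + 1)))
        * qPoch q q (s.entry (r - 1)))

end

/-! The proof runs a Bailey chain one kernel at a time. Put K_a(ρ,n) = 1/((q)_{n-ρ} (q)_{a+n+ρ}),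
with 1/(q)_k = 0 for k < 0. The innermost factor (-1)^s q^{s(s-1)/2} [m+s; m+2s] is the bilateral
sum over ρ of (-1)^ρ q^{ρ(ρ-1)/2} K_m(ρ,s) (`hasSum_seed`). By Bailey's lemma (`sum_bailey`), whose
content is the q-Chu–Vandermonde sum, summing a suitable weight times 1/(q)_{n-k} against K_a(ρ,k)
returns K_a(ρ,n) up to a factor in ρ and a factor in n. Hence for fixed ρ the variables s_r, …, s_1
are summed out one after another (`hasSum_chainTerm`).

The linear terms -s_1-…-s_i spoil the weights relative to q^m. The relation (1-q^{n-ρ}) K_m(ρ,n) =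
K_{m-1}(ρ+1,n) moves part of the kernel to q^{m-1}, where they fit, and each such step lengthens a
geometric sum by one term (`sum_mixedKer`). The factor (-q^{m/2})_s contributes a denominator 1+y
with y = q^{ρ+m/2}.

Interchanging the sums leaves a bilateral series of terms (-1)^ρ q^{…} S(y)/(1+y) with S
palindromic. Averaging over ρ ↦ -m-ρ, that is y ↦ 1/y, cancels the denominator and leaves S(y)
∑_{l≤m} (-y)^l (`halfTerm_add_reflect`). Each monomial in y gives a theta series, evaluated by the
Jacobi triple product (`hasSum_jacobi`).

The last identity is the second one at m = 0, where only s_r = 0 survives; at q = 0 it is a finite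
count. -/

open Filter Topology

/-! ### Infinite and finite q-products -/

theorem multipliable_qInf {q : ℂ} (hq : ‖q‖ < 1) (a : ℂ) :
    Multipliable fun j : ℕ => (1 - a * q ^ j) := by
  have h : Summable fun j : ℕ => ‖-(a * q ^ j)‖ := by
    simp only [norm_neg, norm_mul, norm_pow]
    exact (summable_geometric_of_lt_one (norm_nonneg _) hq).mul_left _
  simpa [sub_eq_add_neg] using multipliable_one_add_of_summable h

theorem qInf_eq_mul {q : ℂ} (hq : ‖q‖ < 1) (a : ℂ) : qInf a q = (1 - a) * qInf (a * q) q := by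
  unfold qInf
  have h : Multipliable fun j : ℕ => (1 - a * q ^ (j + 1)) := by
    simpa [pow_succ', mul_assoc] using multipliable_qInf hq (a * q)
  have h2 := tprod_eq_zero_mul' (f := fun j : ℕ => 1 - a * q ^ j) h
  rw [h2]
  simp only [pow_zero, mul_one, pow_succ', mul_assoc]

theorem qInf_ne_zero {q : ℂ} (hq : ‖q‖ < 1) {a : ℂ} (h : ∀ j : ℕ, a * q ^ j ≠ 1) :
    qInf a q ≠ 0 := by
  have hs : Summable fun j : ℕ => ‖-(a * q ^ j)‖ := by
    simp only [norm_neg, norm_mul, norm_pow]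
    exact (summable_geometric_of_lt_one (norm_nonneg _) hq).mul_left _
  have := tprod_one_add_ne_zero_of_summable (f := fun j : ℕ => -(a * q ^ j))
    (fun j => by rw [← sub_eq_add_neg]; exact sub_ne_zero.2 (h j).symm) hs
  simpa [qInf, sub_eq_add_neg] using this

theorem qInf_eq_zero {q : ℂ} {a : ℂ} {j : ℕ} (h : a * q ^ j = 1) :
    qInf a q = 0 :=
  tprod_of_exists_eq_zero ⟨j, by simp [h]⟩

theorem qInf_ne_zero_of_norm_lt {q : ℂ} (hq : ‖q‖ < 1) {a : ℂ} (ha : ‖a‖ < 1) :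
    qInf a q ≠ 0 := by
  refine qInf_ne_zero hq fun j h => ?_
  have h1 : ‖a * q ^ j‖ < 1 := by
    rw [norm_mul, norm_pow]
    exact mul_lt_one_of_nonneg_of_lt_one_left (norm_nonneg _) ha
      (pow_le_one₀ (norm_nonneg _) hq.le)
  simp [h] at h1

/-- The finite product `(a; q)_n`. -/
noncomputable def finPoch (q a : ℂ) (n : ℕ) : ℂ := ∏ i ∈ range n, (1 - a * q ^ i)

theorem finPoch_zero (q a : ℂ) : finPoch q a 0 = 1 := by simp [finPoch]

theorem finPoch_succ (q a : ℂ) (n : ℕ) :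
    finPoch q a (n + 1) = finPoch q a n * (1 - a * q ^ n) := prod_range_succ _ _

theorem finPoch_succ' (q a : ℂ) (n : ℕ) :
    finPoch q a (n + 1) = (1 - a) * finPoch q (a * q) n := by
  simp only [finPoch, prod_range_succ', pow_succ', pow_zero, mul_one, mul_assoc]
  ring

theorem finPoch_mul_qInf {q : ℂ} (hq : ‖q‖ < 1) (a : ℂ) (n : ℕ) :
    finPoch q a n * qInf (a * q ^ n) q = qInf a q := by
  induction n with
  | zero => simp [finPoch_zero]
  | succ n ih =>
    rw [← ih, qInf_eq_mul hq (a * q ^ n), finPoch_succ, pow_succ]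
    ring_nf

theorem tendsto_finPoch {q : ℂ} (hq : ‖q‖ < 1) (a : ℂ) :
    Tendsto (fun n => finPoch q a n) atTop (𝓝 (qInf a q)) :=
  (multipliable_qInf hq a).hasProd.tendsto_prod_nat

theorem tendsto_qInf_mul_pow {q : ℂ} (hq : ‖q‖ < 1) {a : ℂ} (h : qInf a q ≠ 0) :
    Tendsto (fun n : ℕ => qInf (a * q ^ n) q) atTop (𝓝 1) := by
  have h1 := (tendsto_finPoch hq a).inv₀ h |>.const_mul (qInf a q)
  rw [mul_inv_cancel₀ h] at h1
  refine h1.congr fun n => ?_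
  have h2 := finPoch_mul_qInf hq a n
  have h3 : finPoch q a n ≠ 0 := fun h0 => h (by rw [← h2, h0, zero_mul])
  rw [← h2]; field_simp

theorem qInf_zpow_eq {q : ℂ} (hq : ‖q‖ < 1) (hq0 : q ≠ 0) (a : ℂ) (k : ℤ) :
    qInf (a * q ^ k) q = (1 - a * q ^ k) * qInf (a * q ^ (k + 1)) q := by
  rw [qInf_eq_mul hq, zpow_add_one₀ hq0, mul_assoc]

/-- The reciprocal `1 / (q)_k`, which vanishes for `k < 0`. -/
noncomputable def rq (q : ℂ) (k : ℤ) : ℂ := (qPoch q q k)⁻¹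

/-- Holds for negative k as well: there `qPoch q q k` is a quotient by zero, hence 0, and its
inverse 0 is the conventional value of 1/(q)_k. -/
theorem rq_eq (q : ℂ) (k : ℤ) : rq q k = qInf (q * q ^ k) q / qInf q q := by
  simp [rq, qPoch]

theorem rq_of_neg {q : ℂ} (hq0 : q ≠ 0) {k : ℤ} (hk : k < 0) : rq q k = 0 := by
  rw [rq_eq, qInf_eq_zero (j := (-1 - k).toNat), zero_div]
  rw [← zpow_natCast, Int.toNat_of_nonneg (by omega), mul_assoc, ← zpow_add₀ hq0,
    ← zpow_one_add₀ hq0]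
  simp

theorem qInf_self_ne_zero {q : ℂ} (hq : ‖q‖ < 1) : qInf q q ≠ 0 :=
  qInf_ne_zero_of_norm_lt hq hq

theorem rq_zero {q : ℂ} (hq : ‖q‖ < 1) : rq q 0 = 1 := by
  simp [rq_eq, qInf_self_ne_zero hq]

theorem rq_succ {q : ℂ} (hq : ‖q‖ < 1) (hq0 : q ≠ 0) (k : ℤ) :
    rq q k = (1 - q ^ (k + 1)) * rq q (k + 1) := by
  rw [rq_eq, rq_eq, qInf_zpow_eq hq hq0, ← zpow_one_add₀ hq0, add_comm 1 k]
  ring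

theorem finPoch_mul_rq {q : ℂ} (hq : ‖q‖ < 1) (hq0 : q ≠ 0) (b : ℤ) (n : ℕ) :
    finPoch q (q ^ (b + 1)) n * rq q (b + n) = rq q b := by
  rw [rq_eq, rq_eq, ← mul_div_assoc]
  congr 1
  have := finPoch_mul_qInf hq (q ^ (b + 1)) n
  rw [← zpow_natCast, ← zpow_add₀ hq0] at this
  rw [← zpow_one_add₀ hq0, ← zpow_one_add₀ hq0, add_comm 1 b, ← this]
  congr 3; ring

theorem rq_natCast {q : ℂ} (hq : ‖q‖ < 1) (hq0 : q ≠ 0) (n : ℕ) :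
    rq q n = (finPoch q q n)⁻¹ := by
  have := finPoch_mul_rq hq hq0 0 n
  simp [rq_zero hq] at this
  exact eq_inv_of_mul_eq_one_right this

theorem tendsto_rq {q : ℂ} (hq : ‖q‖ < 1) (b : ℤ) :
    Tendsto (fun n : ℕ => rq q (n + b)) atTop (𝓝 (qInf q q)⁻¹) := by
  have h0 : Tendsto (fun n : ℕ => rq q n) atTop (𝓝 (qInf q q)⁻¹) := by
    have := (tendsto_qInf_mul_pow hq (qInf_self_ne_zero hq)).div_const (qInf q q)
    rw [one_div] at this
    simpa [rq_eq] using this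
  have h1 : Tendsto (fun n : ℕ => (n + b).toNat) atTop atTop := by
    refine tendsto_atTop.2 fun c => ?_
    filter_upwards [eventually_ge_atTop ((c : ℤ) - b).toNat] with n hn
    omega
  refine (h0.comp h1).congr' ?_
  filter_upwards [eventually_ge_atTop (-b).toNat] with n hn
  simp only [Function.comp]
  rw [Int.toNat_of_nonneg (by omega)]

theorem exists_bound_of_tendsto {f : ℕ → ℂ} {x : ℂ} (h : Tendsto f atTop (𝓝 x)) :
    ∃ K, 0 ≤ K ∧ ∀ n, ‖f n‖ ≤ K := by
  obtain ⟨K, hK⟩ := (Metric.isBounded_range_of_tendsto f h).exists_norm_le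
  exact ⟨K, (norm_nonneg _).trans (hK _ ⟨0, rfl⟩), fun n => hK _ ⟨n, rfl⟩⟩

theorem exists_rq_bound {q : ℂ} (hq : ‖q‖ < 1) (hq0 : q ≠ 0) :
    ∃ K, 0 ≤ K ∧ ∀ k, ‖rq q k‖ ≤ K := by
  obtain ⟨K, hK, h⟩ := exists_bound_of_tendsto (tendsto_rq hq 0)
  refine ⟨K, hK, fun k => ?_⟩
  rcases lt_or_ge k 0 with hk | hk
  · simpa [rq_of_neg hq0 hk] using hK
  · lift k to ℕ using hk
    simpa using h k

theorem qPoch_succ {q : ℂ} (hq : ‖q‖ < 1) (hq0 : q ≠ 0) (a : ℂ) {k : ℤ}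
    (h : a * q ^ k ≠ 1) :
    qPoch a q (k + 1) = qPoch a q k * (1 - a * q ^ k) := by
  unfold qPoch
  rw [qInf_zpow_eq hq hq0 a k]
  have : 1 - a * q ^ k ≠ 0 := sub_ne_zero.2 h.symm
  by_cases h0 : qInf (a * q ^ (k + 1)) q = 0
  · simp [h0]
  · field_simp

theorem tendsto_qPoch {q : ℂ} (hq : ‖q‖ < 1) (hq0 : q ≠ 0) (a : ℂ) (lo : ℤ)
    (h : ∀ k, lo ≤ k → a * q ^ k ≠ 1) :
    Tendsto (fun n : ℕ => qPoch a q (lo + n)) atTop (𝓝 (qInf a q)) := by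
  have h1 : qInf (a * q ^ lo) q ≠ 0 := qInf_ne_zero hq fun j => by
    rw [mul_assoc, ← zpow_natCast, ← zpow_add₀ hq0]; exact h _ (by omega)
  have := (tendsto_qInf_mul_pow hq h1).inv₀ one_ne_zero |>.const_mul (qInf a q)
  rw [inv_one, mul_one] at this
  refine this.congr fun n => ?_
  rw [qPoch, zpow_add₀ hq0, zpow_natCast, ← mul_assoc, div_eq_mul_inv]

theorem exists_qPoch_bound {q : ℂ} (hq : ‖q‖ < 1) (hq0 : q ≠ 0) (a : ℂ) (lo : ℤ)
    (h : ∀ k, lo ≤ k → a * q ^ k ≠ 1) :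
    ∃ K, 0 ≤ K ∧ ∀ k, lo ≤ k → ‖qPoch a q k‖ ≤ K := by
  obtain ⟨K, hK, hb⟩ := exists_bound_of_tendsto (tendsto_qPoch hq hq0 a lo h)
  refine ⟨K, hK, fun k hk => ?_⟩
  have := hb (k - lo).toNat
  rwa [Int.toNat_of_nonneg (by omega), add_sub_cancel] at this

theorem exists_qPoch_inv_bound {q : ℂ} (hq : ‖q‖ < 1) (hq0 : q ≠ 0) (a : ℂ) (lo : ℤ)
    (h : ∀ k, lo ≤ k → a * q ^ k ≠ 1) (h0 : qInf a q ≠ 0) :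
    ∃ K, 0 ≤ K ∧ ∀ k, lo ≤ k → ‖(qPoch a q k)⁻¹‖ ≤ K := by
  obtain ⟨K, hK, hb⟩ := exists_bound_of_tendsto ((tendsto_qPoch hq hq0 a lo h).inv₀ h0)
  refine ⟨K, hK, fun k hk => ?_⟩
  have := hb (k - lo).toNat
  rwa [Int.toNat_of_nonneg (by omega), add_sub_cancel] at this

/-! ### The q-Chu–Vandermonde sum -/

theorem finPoch_ne_zero {q a : ℂ} (h : ∀ j : ℕ, a * q ^ j ≠ 1) (n : ℕ) : finPoch q a n ≠ 0 :=
  prod_ne_zero_iff.2 fun i _ => sub_ne_zero.2 (h i).symm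

theorem pow_succ_ne_one {q : ℂ} (hq : ‖q‖ < 1) (n : ℕ) : q ^ (n + 1) ≠ 1 := fun h => by
  have := pow_lt_one₀ (norm_nonneg q) hq (Nat.succ_ne_zero n)
  rw [← norm_pow, h] at this
  simp at this

theorem finPoch_self_ne_zero {q : ℂ} (hq : ‖q‖ < 1) (n : ℕ) : finPoch q q n ≠ 0 :=
  finPoch_ne_zero (fun j => by rw [← pow_succ']; exact pow_succ_ne_one hq j) n

/-- The `q`-Chu–Vandermonde sum. At `c = 0` it is the `q`-binomial theorem. -/
theorem sum_qChuVandermonde {q : ℂ} (hq : ‖q‖ < 1) (N : ℕ) : ∀ c e : ℂ,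
    (∀ j : ℕ, c * q ^ j ≠ 1) →
    ∑ j ∈ range (N + 1), (finPoch q q j)⁻¹ * (finPoch q q (N - j))⁻¹ *
      (q ^ (j.choose 2) * (∏ i ∈ range j, (c * q ^ i - e)) / finPoch q c j)
      = (finPoch q q N)⁻¹ * (finPoch q e N / finPoch q c N) := by
  induction N with
  | zero => intro c e _; simp [finPoch_zero]
  | succ N ih =>
    intro c e hc
    set R : ℕ → ℂ := fun j => (finPoch q q j)⁻¹ with hR
    set T : ℂ → ℕ → ℂ := fun c j =>
      q ^ (j.choose 2) * (∏ i ∈ range j, (c * q ^ i - e)) / finPoch q c j with hT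
    have hRs : ∀ j, R (j + 1) * (1 - q ^ (j + 1)) = R j := fun j => by
      have h1 := finPoch_self_ne_zero hq j
      have h2 : 1 - q ^ (j + 1) ≠ 0 := sub_ne_zero.2 (pow_succ_ne_one hq j).symm
      simp only [hR, finPoch_succ, ← pow_succ']
      field_simp
    have hc' : ∀ j : ℕ, c * q * q ^ j ≠ 1 := fun j => by
      rw [mul_assoc, ← pow_succ']; exact hc _
    have h1c : 1 - c ≠ 0 := sub_ne_zero.2 (by simpa using (hc 0).symm)
    have hTs : ∀ j, T c (j + 1) = q ^ j * ((c - e) / (1 - c)) * T (c * q) j := fun j => by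
      have h1 := finPoch_ne_zero hc' j
      have h2 : ∏ i ∈ range (j + 1), (c * q ^ i - e)
          = (c - e) * ∏ i ∈ range j, (c * q * q ^ i - e) := by
        rw [prod_range_succ', mul_comm, pow_zero, mul_one]
        congr 1
        exact prod_congr rfl fun i _ => by rw [pow_succ']; ring
      simp only [hT, finPoch_succ', h2, Nat.choose_succ_succ' j 1, Nat.choose_one_right, pow_add]
      field_simp
    -- A Pascal-type recursion from 1-q^{N+1} = (1-q^{N+1-j}) + q^{N+1-j}(1-q^j). The first piece
    -- lowers N at the same c; the second shifts j and replaces c by cq, which is why the induction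
    -- quantifies over c.
    have key : (1 - q ^ (N + 1)) * ∑ j ∈ range (N + 2), R j * R (N + 1 - j) * T c j
        = ∑ j ∈ range (N + 1), R j * R (N - j) * T c j
          + q ^ N * ((c - e) / (1 - c)) * ∑ j ∈ range (N + 1), R j * R (N - j) * T (c * q) j := by
      have e1 : ∑ j ∈ range (N + 2), R j * R (N + 1 - j) * (1 - q ^ (N + 1 - j)) * T c j
          = ∑ j ∈ range (N + 1), R j * R (N - j) * T c j := by
        rw [sum_range_succ]
        simp only [Nat.sub_self, pow_zero, sub_self, mul_zero, zero_mul, add_zero]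
        refine sum_congr rfl fun j hj => ?_
        rw [mem_range] at hj
        rw [Nat.sub_add_comm (by omega), mul_assoc (R j), hRs]
      have e2 : ∑ j ∈ range (N + 2), R j * R (N + 1 - j) * (q ^ (N + 1 - j) * (1 - q ^ j)) * T c j
          = q ^ N * ((c - e) / (1 - c)) * ∑ j ∈ range (N + 1), R j * R (N - j) * T (c * q) j := by
        rw [sum_range_succ', mul_sum]
        simp only [pow_zero, sub_self, mul_zero, zero_mul, add_zero]
        refine sum_congr rfl fun j hj => ?_
        rw [mem_range] at hj
        rw [hTs, Nat.add_sub_add_right, ← hRs j]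
        have : q ^ N = q ^ (N - j) * q ^ j := by rw [← pow_add]; congr 1; omega
        rw [this]; ring
      rw [← e1, ← e2, mul_sum, ← sum_add_distrib]
      refine sum_congr rfl fun j hj => ?_
      rw [mem_range] at hj
      have : q ^ (N + 1) = q ^ (N + 1 - j) * q ^ j := by rw [← pow_add]; congr 1; omega
      rw [this]; ring
    have h2 : 1 - q ^ (N + 1) ≠ 0 := sub_ne_zero.2 (pow_succ_ne_one hq N).symm
    refine mul_left_cancel₀ h2 ?_
    rw [key, ih c e hc, ih (c * q) e hc']
    change _ = (1 - q ^ (N + 1)) * (R (N + 1) * _)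
    rw [← mul_assoc (1 - q ^ (N + 1)), mul_comm (1 - q ^ (N + 1)), hRs N]
    have e3 : finPoch q c (N + 1) = (1 - c) * finPoch q (c * q) N := finPoch_succ' ..
    have e4 := finPoch_succ q c N
    have h5 := finPoch_ne_zero hc N
    have h6 := finPoch_ne_zero hc' N
    have h7 : 1 - c * q ^ N ≠ 0 := sub_ne_zero.2 (hc N).symm
    have e5 : finPoch q (c * q) N = finPoch q c N * (1 - c * q ^ N) / (1 - c) := by
      field_simp; rw [← e4, e3]; ring
    have h8 := finPoch_self_ne_zero hq N
    rw [e5, e4, finPoch_succ q e N]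
    simp only [hR]
    have h9 : 1 - q ^ N * c ≠ 0 := by rwa [mul_comm]
    field_simp
    ring

/-! ### Bailey's lemma for a single kernel -/

theorem sum_Icc_eq_sum_range {f : ℤ → ℂ} {lo r n : ℤ} (hr : lo ≤ r) (hn : r ≤ n)
    (hf : ∀ k, k < r → f k = 0) :
    ∑ k ∈ Icc lo n, f k = ∑ j ∈ range ((n - r).toNat + 1), f (r + j) := by
  have h1 : ∑ k ∈ Icc lo n, f k = ∑ k ∈ Icc r n, f k := by
    refine (sum_subset (Icc_subset_Icc_left hr) fun k hk hk' => hf k ?_).symm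
    rw [mem_Icc] at hk hk'
    omega
  rw [h1]
  refine sum_nbij' (fun k => (k - r).toNat) (fun j => r + j) ?_ ?_ ?_ ?_ ?_
  · intro k hk; rw [mem_Icc] at hk; rw [mem_range]; omega
  · intro j hj; rw [mem_range] at hj; rw [mem_Icc]; omega
  · intro k hk; rw [mem_Icc] at hk; omega
  · intro j hj; omega
  · intro k hk; rw [mem_Icc] at hk; congr 1; omega

theorem zpow_ne_one {q : ℂ} (hq : ‖q‖ < 1) {k : ℤ} (hk : 0 < k) : q ^ k ≠ 1 := by
  lift k to ℕ using hk.le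
  obtain ⟨j, rfl⟩ : ∃ j, k = j + 1 := ⟨k - 1, by omega⟩
  exact_mod_cast pow_succ_ne_one hq j

/-- The kernel `1 / ((q)_{n-r} (q)_{a+n+r})` of a Bailey pair relative to `q^a`. -/
noncomputable def baileyKer (q : ℂ) (a r n : ℤ) : ℂ := rq q (n - r) * rq q (a + n + r)

theorem baileyKer_symm (q : ℂ) (a r n : ℤ) : baileyKer q a (-a - r) n = baileyKer q a r n := by
  unfold baileyKer
  rw [mul_comm]; congr 2 <;> ring

/-- The terms with k < r vanish, and after k = r + j this is q-Chu–Vandermonde with c = q^{a+2r+1}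
and e = εq^r. The assumption 0 ≤ a + 2r keeps c q^j away from 1. -/
theorem sum_bailey_aux {q : ℂ} (hq : ‖q‖ < 1) (hq0 : q ≠ 0) {a lo : ℤ} {ε : ℂ} {w g : ℤ → ℂ}
    (hw : ∀ k, lo ≤ k → w (k + 1) = w k * (q ^ k * (q ^ (a + k + 1) - ε)))
    (hg : ∀ k, lo ≤ k → g (k + 1) = g k * (1 - ε * q ^ k))
    {r n : ℤ} (hr : lo ≤ r) (hr' : 0 ≤ a + 2 * r) {v : ℂ} (hv : v * g r = w r) :
    ∑ k ∈ Icc lo n, w k * rq q (n - k) * baileyKer q a r k = v * g n * baileyKer q a r n := by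
  unfold baileyKer
  rcases lt_or_ge n r with hn | hn
  · rw [rq_of_neg hq0 (show n - r < 0 by omega), zero_mul, mul_zero]
    refine sum_eq_zero fun k hk => ?_
    rw [mem_Icc] at hk
    rw [rq_of_neg hq0 (show k - r < 0 by omega), zero_mul, mul_zero]
  rw [sum_Icc_eq_sum_range hr hn]
  swap
  · intro k hk
    rw [rq_of_neg hq0 (show k - r < 0 by omega), zero_mul, mul_zero]
  obtain ⟨N, rfl⟩ : ∃ N : ℕ, n = r + N := ⟨(n - r).toNat, by omega⟩
  set c : ℂ := q ^ (a + 2 * r + 1) with hcdef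
  have hc : ∀ j : ℕ, c * q ^ j ≠ 1 := fun j => by
    rw [hcdef, ← zpow_natCast, ← zpow_add₀ hq0]
    exact zpow_ne_one hq (by omega)
  set e : ℂ := ε * q ^ r with hedef
  have hwj : ∀ j : ℕ, w (r + j) = w r * (q ^ (j.choose 2) * ∏ i ∈ range j, (c * q ^ i - e)) := by
    intro j
    induction j with
    | zero => simp
    | succ j ih =>
      rw [Nat.cast_succ, ← add_assoc, hw _ (by omega), ih, Nat.choose_succ_succ' j 1,
        Nat.choose_one_right, prod_range_succ, pow_add, hcdef, hedef,
        show a + (r + (j : ℤ)) + 1 = (a + 2 * r + 1) + j - r by ring, zpow_add₀ hq0 r,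
        zpow_sub₀ hq0, zpow_add₀ hq0 (a + 2 * r + 1), zpow_natCast]
      have := zpow_ne_zero r hq0
      field_simp
  have hgj : ∀ j : ℕ, g (r + j) = g r * finPoch q e j := by
    intro j
    induction j with
    | zero => simp [finPoch_zero]
    | succ j ih =>
      rw [Nat.cast_succ, ← add_assoc, hg _ (by omega), ih, finPoch_succ, hedef, zpow_add₀ hq0,
        zpow_natCast]
      ring
  have hb : ∀ j : ℕ, rq q (a + (r + j) + r) = rq q (a + 2 * r) / finPoch q c j := by
    intro j
    rw [eq_div_iff (finPoch_ne_zero hc j), mul_comm, ← finPoch_mul_rq hq hq0 (a + 2 * r) j]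
    congr 2; ring
  have key := sum_qChuVandermonde hq N c e hc
  rw [hb, hgj]
  have e1 : rq q (r + (N : ℤ) - r) = (finPoch q q N)⁻¹ := by
    rw [add_sub_cancel_left, rq_natCast hq hq0]
  rw [e1]
  calc _ = ∑ j ∈ range (N + 1), (w r * rq q (a + 2 * r)) *
        ((finPoch q q j)⁻¹ * (finPoch q q (N - j))⁻¹ *
        (q ^ (j.choose 2) * (∏ i ∈ range j, (c * q ^ i - e)) / finPoch q c j)) := by
        rw [add_sub_cancel_left, Int.toNat_natCast]
        refine sum_congr rfl fun j hj => ?_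
        rw [mem_range] at hj
        rw [hwj, hb, add_sub_cancel_left, rq_natCast hq hq0,
          show r + (N : ℤ) - (r + j) = ((N - j : ℕ) : ℤ) by omega, rq_natCast hq hq0]
        ring
    _ = _ := by rw [← mul_sum, key, ← hv]; ring

/-- Bailey's lemma for one term of the pair relative to `q^a`: the weight `w` sends the kernel
to a multiple of itself. -/
theorem sum_bailey {q : ℂ} (hq : ‖q‖ < 1) (hq0 : q ≠ 0) {a lo : ℤ} {ε : ℂ} {w g v : ℤ → ℂ}
    (hlo : 2 * lo ≤ 1 - a)
    (hw : ∀ k, lo ≤ k → w (k + 1) = w k * (q ^ k * (q ^ (a + k + 1) - ε)))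
    (hg : ∀ k, lo ≤ k → g (k + 1) = g k * (1 - ε * q ^ k))
    (hv : ∀ k, lo ≤ k → v k * g k = w k) (hsymm : ∀ k, v (-a - k) = v k) (r n : ℤ) :
    ∑ k ∈ Icc lo n, w k * rq q (n - k) * baileyKer q a r k
      = v r * g n * baileyKer q a r n := by
  -- The kernel and v are invariant under r ↦ -a-r, so a + 2r ≥ 0 may be assumed. Then 2r ≥ -a ≥
  -- 2lo-1, and integrality gives r ≥ lo.
  rcases le_or_gt 0 (a + 2 * r) with h | h
  · exact sum_bailey_aux hq hq0 hw hg (by omega) h (hv r (by omega))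
  · simp only [← baileyKer_symm q a r]
    rw [← hsymm r]
    exact sum_bailey_aux hq hq0 hw hg (by omega) (by omega) (hv _ (by omega))

/-! ### The q-binomial theorem and the Jacobi triple product -/

theorem summable_norm_zpow_quadratic {t : ℂ} (ht : ‖t‖ < 1) (ht0 : t ≠ 0) {A : ℤ} (hA : 1 ≤ A)
    (B : ℤ) : Summable fun n : ℤ => ‖t ^ (A * n ^ 2 + B * n)‖ := by
  have h0 : 0 < ‖t‖ := norm_pos_iff.2 ht0
  have hg : Summable fun n : ℤ => ‖t‖ ^ n.natAbs := by
    refine Summable.of_nat_of_neg ?_ ?_ <;>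
      simpa using summable_geometric_of_lt_one (norm_nonneg _) ht
  -- Geometric majorant: completing the square gives An² + Bn ≥ |n| - (|B|+1)².
  refine (hg.mul_left (‖t‖ ^ (-(|B| + 1) ^ 2))).of_nonneg_of_le (fun _ => norm_nonneg _)
    fun n => ?_
  rw [norm_zpow, ← zpow_natCast, ← zpow_add₀ h0.ne', Int.natCast_natAbs]
  refine zpow_le_zpow_right_of_le_one₀ h0 ht.le ?_
  have h1 : -(|B| * |n|) ≤ B * n := by rw [← abs_mul]; exact neg_abs_le _
  have h2 : |n| ^ 2 = n ^ 2 := sq_abs n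
  nlinarith [abs_nonneg B, abs_nonneg n, sq_nonneg (|n| - (|B| + 1)), mul_nonneg (sub_nonneg.2 hA) (sq_nonneg n), mul_nonneg (abs_nonneg B) (abs_nonneg n)]

theorem finPoch_zero_right (q : ℂ) (n : ℕ) : finPoch q 0 n = 1 := by simp [finPoch]

/-- The `q`-binomial theorem. -/
theorem sum_qBinomial {q : ℂ} (hq : ‖q‖ < 1) (x : ℂ) (N : ℕ) :
    ∑ j ∈ range (N + 1), (finPoch q q j)⁻¹ * (finPoch q q (N - j))⁻¹ *
      (q ^ (j.choose 2) * (-x) ^ j) = (finPoch q q N)⁻¹ * finPoch q x N := by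
  simpa [finPoch_zero_right] using sum_qChuVandermonde hq N 0 x (by simp)

theorem pow_choose_two_of_sq {t q : ℂ} (h : t ^ 2 = q) (j : ℕ) :
    q ^ j.choose 2 = t ^ ((j : ℤ) ^ 2 - j) := by
  have h1 : (j.choose 2 : ℤ) * 2 = (j : ℤ) ^ 2 - j := by
    have h2 := Nat.choose_two_right j
    have h3 : j.choose 2 * 2 = j * (j - 1) := by
      rw [h2]; exact Nat.div_mul_cancel (Nat.even_mul_pred_self j).two_dvd
    rcases j with _ | j
    · simp
    · rw [Nat.add_sub_cancel] at h3
      have h4 : (((j + 1).choose 2 * 2 : ℕ) : ℤ) = ((j + 1) * j : ℕ) := by rw [h3]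
      push_cast at h4 ⊢; linarith
  rw [← h1, ← h, ← pow_mul, ← zpow_natCast]
  congr 1; push_cast; ring

theorem neg_one_zpow_mul_self (n : ℤ) : ((-1 : ℂ) ^ n) * (-1) ^ n = 1 := by
  rw [← mul_zpow]; simp

/-- The reciprocals vanish outside -b ≤ n ≤ M-b, so the bilateral sum is the q-binomial theorem with
j = n + b. The shift b serves both the triple product (b = N, M = 2N) and the seed (b = n, M =
m+2n). -/
theorem hasSum_qBinomial_shift {t q : ℂ} (ht : ‖t‖ < 1) (h : t ^ 2 = q) (ht0 : t ≠ 0) {w : ℂ}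
    (hw : w ≠ 0) (b : ℤ) (M : ℕ) :
    HasSum (fun n : ℤ => (-1) ^ n * (t ^ (n ^ 2) * w ^ n) * (rq q (b + n) * rq q (M - b - n)))
      ((-1) ^ b * (t ^ (b ^ 2) * w ^ (-b)) *
        ((finPoch q q M)⁻¹ * finPoch q (w * t ^ (1 - 2 * b)) M)) := by
  have hq0 : q ≠ 0 := h ▸ pow_ne_zero 2 ht0
  have hq : ‖q‖ < 1 := by
    rw [← h, norm_pow]; exact pow_lt_one₀ (norm_nonneg _) ht two_ne_zero
  have hinj : Function.Injective fun j : ℕ => (j : ℤ) - b := fun i j hij => by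
    simpa using hij
  rw [← hinj.hasSum_iff]
  · rw [← sum_qBinomial hq, mul_sum]
    have key : ∀ j : ℕ, j ∈ range (M + 1) →
        (-1) ^ b * (t ^ (b ^ 2) * w ^ (-b)) * ((finPoch q q j)⁻¹ * (finPoch q q (M - j))⁻¹ *
          (q ^ j.choose 2 * (-(w * t ^ (1 - 2 * b))) ^ j))
        = (-1) ^ ((j : ℤ) - b) * (t ^ (((j : ℤ) - b) ^ 2) * w ^ ((j : ℤ) - b)) *
          (rq q (b + (j - b)) * rq q (M - b - (j - b))) := fun j hj => by
      rw [mem_range] at hj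
      rw [show b + ((j : ℤ) - b) = j by ring, show (M : ℤ) - b - (j - b) = ((M - j : ℕ) : ℤ) by omega,
        rq_natCast hq hq0, rq_natCast hq hq0, pow_choose_two_of_sq h, neg_pow, mul_pow,
        show ((j : ℤ) - b) ^ 2 = b ^ 2 + (j ^ 2 - j) + (1 - 2 * b) * j by ring,
        zpow_add₀ ht0, zpow_add₀ ht0 (b ^ 2), zpow_mul, zpow_natCast, zpow_sub₀ hw,
        zpow_sub₀ (by norm_num : (-1 : ℂ) ≠ 0), zpow_natCast, zpow_natCast, zpow_neg]
      have := neg_one_zpow_mul_self b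
      have h1 : ((-1 : ℂ) ^ b)⁻¹ = (-1) ^ b := inv_eq_of_mul_eq_one_left this
      rw [div_eq_mul_inv ((-1 : ℂ) ^ j), h1]
      ring
    rw [sum_congr rfl key]
    refine hasSum_sum_of_ne_finset_zero fun j hj => ?_
    rw [mem_range] at hj
    simp only [Function.comp]
    rw [rq_of_neg hq0 (show (M : ℤ) - b - (j - b) < 0 by omega), mul_zero, mul_zero]
  · intro n hn
    have : b + n < 0 := by
      by_contra hc
      exact hn ⟨(b + n).toNat, by simp only; omega⟩
    rw [rq_of_neg hq0 this, zero_mul, mul_zero]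

theorem finPoch_add {q a : ℂ} (n k : ℕ) :
    finPoch q a (n + k) = finPoch q a n * finPoch q (a * q ^ n) k := by
  unfold finPoch
  rw [prod_range_add]
  simp [pow_add, mul_assoc]

/-- Each factor 1 - w t^{1-2j} is turned over into -w t^{1-2j} (1 - t^{2j-1}/w); the extracted
monomials multiply to the prefactor. -/
theorem finPoch_reflect {t q : ℂ} (h : t ^ 2 = q) (ht0 : t ≠ 0) {w : ℂ} (hw : w ≠ 0) (N : ℕ) :
    (-1) ^ (N : ℤ) * (t ^ ((N : ℤ) ^ 2) * w ^ (-(N : ℤ))) * finPoch q (w * t ^ (1 - 2 * (N : ℤ))) N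
      = finPoch q (t / w) N := by
  induction N with
  | zero => simp [finPoch_zero]
  | succ N ih =>
    rw [finPoch_succ q (t / w), ← ih, finPoch_succ',
      show w * t ^ (1 - 2 * ((N + 1 : ℕ) : ℤ)) * q = w * t ^ (1 - 2 * (N : ℤ)) by
        rw [← h, mul_assoc, ← zpow_natCast, ← zpow_add₀ ht0]; congr 2; push_cast; ring]
    have e1 : (-1 : ℂ) ^ ((N + 1 : ℕ) : ℤ) = -(-1) ^ (N : ℤ) := by
      push_cast; rw [zpow_add_one₀ (by norm_num)]; ring
    have e2 : t ^ (((N + 1 : ℕ) : ℤ) ^ 2) = t ^ ((N : ℤ) ^ 2) * t ^ (2 * (N : ℤ) + 1) := by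
      rw [← zpow_add₀ ht0]; congr 1; push_cast; ring
    have e3 : w ^ (-((N + 1 : ℕ) : ℤ)) = w ^ (-(N : ℤ)) * w⁻¹ := by
      rw [← zpow_sub_one₀ hw]; congr 1; push_cast; ring
    have e4 : t ^ (1 - 2 * ((N + 1 : ℕ) : ℤ)) * t ^ (2 * (N : ℤ) + 1) = 1 := by
      rw [← zpow_add₀ ht0, ← zpow_zero t]; congr 1; push_cast; ring
    have e5 : q ^ N * t = t ^ (2 * (N : ℤ) + 1) := by
      rw [zpow_add_one₀ ht0, zpow_mul, zpow_natCast, ← h]; norm_cast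
    have e6 : (1 - w * t ^ (1 - 2 * ((N + 1 : ℕ) : ℤ))) * (t ^ (2 * (N : ℤ) + 1) * w⁻¹)
        = -(1 - t / w * q ^ N) := by
      have : (1 - w * t ^ (1 - 2 * ((N + 1 : ℕ) : ℤ))) * (t ^ (2 * (N : ℤ) + 1) * w⁻¹)
        = t ^ (2 * (N : ℤ) + 1) * w⁻¹
          - (w * w⁻¹) * (t ^ (1 - 2 * ((N + 1 : ℕ) : ℤ)) * t ^ (2 * (N : ℤ) + 1)) := by ring
      rw [this, e4, mul_inv_cancel₀ hw, ← e5]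
      ring
    rw [e1, e2, e3]
    linear_combination (-(-1) ^ (N : ℤ) * (t ^ ((N : ℤ) ^ 2) * w ^ (-(N : ℤ))) *
      finPoch q (w * t ^ (1 - 2 * (N : ℤ))) N) * e6

/-- The Jacobi triple product. -/
theorem hasSum_jacobi {t q : ℂ} (ht : ‖t‖ < 1) (h : t ^ 2 = q) (ht0 : t ≠ 0) {w : ℂ}
    (hw : w ≠ 0) (hs : Summable fun n : ℤ => ‖t ^ (n ^ 2) * w ^ n‖) :
    HasSum (fun n : ℤ => (-1) ^ n * (t ^ (n ^ 2) * w ^ n)) (qInf3 q (t * w) (t / w) q) := by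
  have hq0 : q ≠ 0 := h ▸ pow_ne_zero 2 ht0
  have hq : ‖q‖ < 1 := by
    rw [← h, norm_pow]; exact pow_lt_one₀ (norm_nonneg _) ht two_ne_zero
  have hs' : Summable fun n : ℤ => ‖(-1) ^ n * (t ^ (n ^ 2) * w ^ n)‖ := by
    simpa only [norm_mul, norm_zpow, norm_neg, norm_one, one_zpow, one_mul] using hs
  obtain ⟨K, hK0, hK⟩ := exists_rq_bound hq hq0
  have hfin : ∀ N : ℕ, ∑' n : ℤ, (-1) ^ n * (t ^ (n ^ 2) * w ^ n) * (rq q (N + n) * rq q (N - n))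
      = (finPoch q q (N + N))⁻¹ * (finPoch q (t / w) N * finPoch q (t * w) N) := fun N => by
    have h1 := hasSum_qBinomial_shift ht h ht0 hw N (N + N)
    rw [finPoch_add (a := w * t ^ (1 - 2 * (N : ℤ))), ← mul_assoc, mul_comm _ (finPoch q q _)⁻¹,
      mul_assoc (finPoch q q _)⁻¹, ← mul_assoc ((-1) ^ (N : ℤ) * _) (finPoch _ _ _),
      finPoch_reflect h ht0 hw,
      show w * t ^ (1 - 2 * (N : ℤ)) * q ^ N = t * w by
        rw [← h, ← pow_mul, ← zpow_natCast t (2 * N), mul_assoc, ← zpow_add₀ ht0]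
        push_cast; rw [sub_add_cancel, zpow_one, mul_comm]] at h1
    convert h1.tsum_eq using 7
    push_cast; ring
  -- Let N → ∞ in the finite triple product; boundedness of 1/(q)_k gives the dominating series.
  have l1 : Tendsto (fun N : ℕ => ∑' n : ℤ, (-1) ^ n * (t ^ (n ^ 2) * w ^ n) *
      (rq q (N + n) * rq q (N - n))) atTop
      (𝓝 (∑' n : ℤ, (-1) ^ n * (t ^ (n ^ 2) * w ^ n) * ((qInf q q)⁻¹ * (qInf q q)⁻¹))) := by
    refine tendsto_tsum_of_dominated_convergence (hs'.mul_right (K * K)) (fun n => ?_)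
      (Eventually.of_forall fun N n => ?_)
    · exact ((tendsto_rq hq n).mul (tendsto_rq hq (-n))).const_mul _
    · rw [norm_mul _ (_ * _), norm_mul (rq _ _)]
      exact mul_le_mul_of_nonneg_left (mul_le_mul (hK _) (hK _) (norm_nonneg _) hK0)
        (norm_nonneg _)
  have l2 : Tendsto (fun N : ℕ => (finPoch q q (N + N))⁻¹ *
      (finPoch q (t / w) N * finPoch q (t * w) N)) atTop
      (𝓝 ((qInf q q)⁻¹ * (qInf (t / w) q * qInf (t * w) q))) := by
    refine Tendsto.mul ?_ ((tendsto_finPoch hq _).mul (tendsto_finPoch hq _))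
    exact ((tendsto_finPoch hq q).comp (tendsto_atTop_mono (fun N : ℕ => Nat.le_add_left N N)
      tendsto_id)).inv₀ (qInf_self_ne_zero hq)
  have heq := tendsto_nhds_unique (l1.congr hfin) l2
  rw [tsum_mul_right] at heq
  have h0 := qInf_self_ne_zero hq
  have : qInf3 q (t * w) (t / w) q = ∑' n : ℤ, (-1) ^ n * (t ^ (n ^ 2) * w ^ n) := by
    rw [qInf3]
    calc _ = qInf q q * qInf q q * ((qInf q q)⁻¹ * (qInf (t / w) q * qInf (t * w) q)) := by
          field_simp
      _ = _ := by rw [← heq]; field_simp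
  rw [this]
  exact hs'.of_norm.hasSum

theorem hasSum_theta {t : ℂ} (ht : ‖t‖ < 1) (ht0 : t ≠ 0) {A : ℕ} (hA : 1 ≤ A) (e : ℤ) :
    HasSum (fun n : ℤ => (-1) ^ n * t ^ (A * n ^ 2 + e * n))
      (qInf3 (t ^ (2 * A)) (t ^ (A + e)) (t ^ (A - e)) (t ^ (2 * A))) := by
  have h1 : ∀ n : ℤ, t ^ (A * n ^ 2 + e * n) = (t ^ A) ^ (n ^ 2) * (t ^ e) ^ n := fun n => by
    rw [zpow_add₀ ht0, zpow_mul, zpow_mul, zpow_natCast]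
  have h2 : ‖t ^ A‖ < 1 := by
    rw [norm_pow]; exact pow_lt_one₀ (norm_nonneg _) ht (by omega)
  have := hasSum_jacobi (q := t ^ (2 * A)) h2 (by rw [← pow_mul, mul_comm]) (pow_ne_zero A ht0)
    (zpow_ne_zero e ht0)
    ((summable_norm_zpow_quadratic ht ht0 (A := A) (by exact_mod_cast hA) e).congr
      fun n => by rw [h1])
  simp only [h1]
  rwa [← zpow_natCast t A, ← zpow_add₀ ht0, ← zpow_sub₀ ht0] at this

/-- The unit-like Bailey pair relative to `q^m`. -/
theorem hasSum_seed {t q : ℂ} (ht : ‖t‖ < 1) (h : t ^ 2 = q) (ht0 : t ≠ 0) (m : ℕ) {n : ℤ}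
    (hn : 0 ≤ m + 2 * n) :
    HasSum (fun r : ℤ => (-1) ^ r * t ^ (r ^ 2 - r) * baileyKer q m r n)
      ((-1) ^ n * t ^ (n ^ 2 - n) * qBinom q (m + n) (m + 2 * n)) := by
  have hq0 : q ≠ 0 := h ▸ pow_ne_zero 2 ht0
  have hq : ‖q‖ < 1 := by
    rw [← h, norm_pow]; exact pow_lt_one₀ (norm_nonneg _) ht two_ne_zero
  obtain ⟨M, hM⟩ : ∃ M : ℕ, (M : ℤ) = m + 2 * n := ⟨_, Int.toNat_of_nonneg hn⟩
  have h1 := hasSum_qBinomial_shift ht h ht0 ht0 n M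
  -- With w = t and the index negated, the two reciprocals become exactly the kernel relative to
  -- q^m.
  rw [← (Equiv.neg ℤ).hasSum_iff] at h1
  convert h1 using 1
  · funext r
    simp only [Function.comp, Equiv.neg_apply, baileyKer]
    rw [← zpow_add₀ ht0, hM]
    congr 2
    · simp [zpow_neg]
      rw [← inv_zpow]; norm_num
    · congr 1; ring
    · congr 1; ring
  · rw [← zpow_add₀ ht0, mul_comm (finPoch _ _ _)⁻¹, ← sub_eq_add_neg, ← div_eq_mul_inv]
    congr 1
    have e1 : t * t ^ (1 - 2 * n) = q ^ (-n + 1) := by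
      rw [← h, ← zpow_one_add₀ ht0, ← zpow_natCast, ← zpow_mul]; congr 1; push_cast; ring
    rw [e1]
    unfold qBinom
    split_ifs with hc
    · have h2 := finPoch_mul_rq hq hq0 (-n) M
      have h3 := rq_natCast hq hq0 M
      rw [hM] at h2 h3
      rw [show -n + ((m : ℤ) + 2 * n) = m + n by ring] at h2
      rw [show (m : ℤ) + n - (m + 2 * n) = -n by ring, div_eq_mul_inv _ (finPoch q q M), ← h3]
      have h4 : rq q (m + n) ≠ 0 := by
        obtain ⟨k, hk⟩ : ∃ k : ℕ, (k : ℤ) = m + n := ⟨_, Int.toNat_of_nonneg (by omega)⟩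
        rw [← hk, rq_natCast hq hq0]
        exact inv_ne_zero (finPoch_self_ne_zero hq _)
      rw [div_eq_mul_inv, mul_inv, show qPoch q q (m + n) = (rq q (m + n))⁻¹ by simp [rq]]
      change _ * (rq q _ * rq q _) = _
      rw [← h2]; field_simp
    -- Here n > 0, and the factor of index n - 1 is 1 - q^0; it lies in range because M = m + 2n.
    · have : finPoch q (q ^ (-n + 1)) M = 0 := by
        refine prod_eq_zero (i := (n - 1).toNat) (mem_range.2 (by omega)) ?_
        rw [← zpow_natCast, Int.toNat_of_nonneg (by omega), ← zpow_add₀ hq0]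
        simp
      rw [this, zero_div]

/-! ### Decreasing integer sequences -/

namespace DecSeq

variable {n : ℕ} {lo : ℤ}

theorem entry_eq (s : DecSeq n lo) (j : Fin n) : s.entry (j + 1) = s.1 j := by
  have : 1 ≤ (j : ℕ) + 1 ∧ (j : ℕ) + 1 ≤ n := ⟨by omega, j.2⟩
  simp [entry, this]

theorem le_entry (s : DecSeq n lo) {j : ℕ} (h1 : 1 ≤ j) (hn : j ≤ n) : lo ≤ s.entry j := by
  simp only [entry, h1, hn, and_self, dite_true]
  exact s.2.2 _

theorem entry_antitone (s : DecSeq n lo) {j k : ℕ} (h1 : 1 ≤ j) (hjk : j ≤ k) (hn : k ≤ n) :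
    s.entry k ≤ s.entry j := by
  have h2 := hjk.trans hn
  have h3 := h1.trans hjk
  simp only [entry, h1, hn, h2, h3, and_self, dite_true]
  exact s.2.1 (Fin.mk_le_mk.2 (by omega))

theorem ext_entry {s s' : DecSeq n lo} (h : ∀ j, 1 ≤ j → j ≤ n → s.entry j = s'.entry j) :
    s = s' := by
  refine Subtype.ext (funext fun j => ?_)
  rw [← entry_eq, ← entry_eq]
  exact h _ (by omega) j.2

/-- Build a decreasing sequence from its entries. -/
def mk' (f : ℕ → ℤ) (hf : ∀ j k, 1 ≤ j → j ≤ k → k ≤ n → f k ≤ f j)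
    (hlo : ∀ j, 1 ≤ j → j ≤ n → lo ≤ f j) : DecSeq n lo :=
  ⟨fun j => f (j + 1), fun j k hjk => hf _ _ (by omega) (by have : (j : ℕ) ≤ k := hjk; omega) k.2,
    fun j => hlo _ (by omega) j.2⟩

theorem entry_mk' (f : ℕ → ℤ) (hf : ∀ j k, 1 ≤ j → j ≤ k → k ≤ n → f k ≤ f j)
    (hlo : ∀ j, 1 ≤ j → j ≤ n → lo ≤ f j) {j : ℕ} (h1 : 1 ≤ j) (hn : j ≤ n) :
    (mk' f hf hlo : DecSeq n lo).entry j = f j := by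
  simp only [entry, h1, hn, and_self, dite_true, mk']
  congr 1; omega

/-- Drop the last entry. -/
def init (s : DecSeq (n + 1) lo) : DecSeq n lo :=
  mk' s.entry (fun _ _ h1 hjk hk => s.entry_antitone h1 hjk (by omega))
    fun _ h1 hn => s.le_entry h1 (by omega)

theorem entry_init (s : DecSeq (n + 1) lo) {j : ℕ} (h1 : 1 ≤ j) (hn : j ≤ n) :
    s.init.entry j = s.entry j := entry_mk' _ _ _ h1 hn

/-- Append a last entry. -/
def snoc (s : DecSeq n lo) (k : ℤ) (hk : lo ≤ k) (h : ∀ j, 1 ≤ j → j ≤ n → k ≤ s.entry j) :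
    DecSeq (n + 1) lo :=
  mk' (fun j => if j ≤ n then s.entry j else k)
    (fun i j h1 hij hj => by
      split_ifs with h2 h3 h3
      · exact s.entry_antitone h1 hij h2
      · omega
      · exact h i h1 h3
      · exact le_rfl)
    fun j h1 _ => by
      split_ifs with h2
      exacts [s.le_entry h1 h2, hk]

theorem entry_snoc_of_le (s : DecSeq n lo) {k : ℤ} (hk : lo ≤ k)
    (h : ∀ j, 1 ≤ j → j ≤ n → k ≤ s.entry j) {j : ℕ} (h1 : 1 ≤ j) (hn : j ≤ n) :
    (s.snoc k hk h).entry j = s.entry j := by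
  rw [snoc, entry_mk' _ _ _ h1 (by omega), if_pos hn]

theorem entry_snoc_last (s : DecSeq n lo) {k : ℤ} (hk : lo ≤ k)
    (h : ∀ j, 1 ≤ j → j ≤ n → k ≤ s.entry j) :
    (s.snoc k hk h).entry (n + 1) = k := by
  rw [snoc, entry_mk' _ _ _ (by omega) le_rfl, if_neg (by omega)]

/-- A sequence is its initial part together with its last entry. -/
def snocEquiv (n : ℕ) (lo : ℤ) :
    (Σ s : DecSeq (n + 1) lo, {k : ℤ // k ∈ Icc lo (s.entry (n + 1))}) ≃ DecSeq (n + 2) lo where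
  toFun p := p.1.snoc p.2 (mem_Icc.1 p.2.2).1
    fun _ h1 hj => (mem_Icc.1 p.2.2).2.trans (p.1.entry_antitone h1 hj le_rfl)
  invFun s := ⟨s.init, s.entry (n + 2), mem_Icc.2 ⟨s.le_entry (by omega) le_rfl, by
    rw [s.entry_init (by omega) le_rfl]
    exact s.entry_antitone (by omega) (by omega) le_rfl⟩⟩
  left_inv p := by
    obtain ⟨s, k, hk⟩ := p
    have h1 : (s.snoc k (mem_Icc.1 hk).1 fun _ h1 hj =>
        (mem_Icc.1 hk).2.trans (s.entry_antitone h1 hj le_rfl)).init = s :=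
      ext_entry fun j h1 hj => by
        rw [entry_init _ h1 hj, entry_snoc_of_le _ _ _ h1 hj]
    refine Sigma.ext h1 ?_
    dsimp only
    rw [Subtype.heq_iff_coe_eq]
    · exact entry_snoc_last _ _ _
    · intro x; rw [h1]
  right_inv s := ext_entry fun j h1 hj => by
    rcases Nat.lt_or_ge (n + 1) j with h | h
    · obtain rfl : j = n + 2 := by omega
      exact entry_snoc_last _ _ _
    · rw [entry_snoc_of_le _ _ _ h1 h]
      exact s.entry_init h1 h

/-- Sequences of length one. -/
def oneEquiv (lo : ℤ) : {k : ℤ // lo ≤ k} ≃ DecSeq 1 lo where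
  toFun k := mk' (fun _ => k) (fun _ _ _ _ _ => le_rfl) fun _ _ _ => k.2
  invFun s := ⟨s.entry 1, s.le_entry le_rfl le_rfl⟩
  left_inv k := Subtype.ext (entry_mk' (n := 1) (lo := lo) (fun _ => k.1)
    (fun _ _ _ _ _ => le_rfl) (fun _ _ _ => k.2) le_rfl le_rfl)
  right_inv s := ext_entry fun j h1 hj => by
    obtain rfl : j = 1 := by omega
    exact entry_mk' _ _ _ le_rfl le_rfl

theorem entry_oneEquiv (k : {k : ℤ // lo ≤ k}) : (oneEquiv lo k).entry 1 = k :=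
  entry_mk' (n := 1) (lo := lo) (fun _ => k.1)
    (fun _ _ _ _ _ => le_rfl) (fun _ _ _ => k.2) le_rfl le_rfl

theorem entry_snocEquiv (p : Σ s : DecSeq (n + 1) lo, {k : ℤ // k ∈ Icc lo (s.entry (n + 1))}) :
    (snocEquiv n lo p).entry (n + 2) = p.2 :=
  p.1.entry_snoc_last (mem_Icc.1 p.2.2).1 fun _ h1 hj =>
    (mem_Icc.1 p.2.2).2.trans (p.1.entry_antitone h1 hj le_rfl)

end DecSeq

/-! ### Summing out the variables of a chain -/

/-- The multi-sum summand `∏ w_j(s_j) / ((q)_{s_1-s_2} ⋯ (q)_{s_{n-1}-s_n})`. -/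
noncomputable def chainTerm (q : ℂ) (w : ℕ → ℤ → ℂ) {n : ℕ} {lo : ℤ} (s : DecSeq n lo) : ℂ :=
  (∏ j ∈ Icc 1 n, w j (s.entry j)) * ∏ j ∈ Icc 1 (n - 1), rq q (s.entry j - s.entry (j + 1))

theorem chainTerm_one (q : ℂ) (w : ℕ → ℤ → ℂ) {lo : ℤ} (s : DecSeq 1 lo) :
    chainTerm q w s = w 1 (s.entry 1) := by simp [chainTerm]

theorem chainTerm_succ (q : ℂ) (w : ℕ → ℤ → ℂ) {n : ℕ} {lo : ℤ} (s : DecSeq (n + 2) lo) :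
    chainTerm q w s = chainTerm q w s.init *
      (w (n + 2) (s.entry (n + 2)) * rq q (s.init.entry (n + 1) - s.entry (n + 2))) := by
  unfold chainTerm
  rw [prod_Icc_succ_top (by omega), show n + 2 - 1 = n + 1 from rfl,
    prod_Icc_succ_top (b := n) (f := fun j => rq q (s.entry j - s.entry (j + 1))) (by omega), show n + 1 - 1 = n from rfl,
    s.entry_init (by omega) le_rfl]
  have h1 : ∏ j ∈ Icc 1 (n + 1), w j (s.init.entry j) = ∏ j ∈ Icc 1 (n + 1), w j (s.entry j) :=
    prod_congr rfl fun j hj => by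
      rw [mem_Icc] at hj; rw [s.entry_init hj.1 hj.2]
  have h2 : ∏ j ∈ Icc 1 n, rq q (s.init.entry j - s.init.entry (j + 1))
      = ∏ j ∈ Icc 1 n, rq q (s.entry j - s.entry (j + 1)) :=
    prod_congr rfl fun j hj => by
      rw [mem_Icc] at hj; rw [s.entry_init hj.1 (by omega), s.entry_init (by omega) (by omega)]
  rw [h1, h2]
  ring

section Chain

variable {q : ℂ} {w : ℕ → ℤ → ℂ} {lo : ℤ}

/-- As 1/(q)_k is bounded uniformly in k, the chain is dominated by a constant times a product of
one-variable summable weights. -/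
theorem summable_chainTerm (hq : ‖q‖ < 1) (hq0 : q ≠ 0) (n : ℕ)
    (hw : ∀ j, 1 ≤ j → j ≤ n + 1 → Summable fun k : {k : ℤ // lo ≤ k} => ‖w j k‖) :
    Summable fun s : DecSeq (n + 1) lo => ‖chainTerm q w s‖ := by
  induction n with
  | zero =>
    rw [← (DecSeq.oneEquiv lo).summable_iff]
    refine (hw 1 le_rfl le_rfl).congr fun k => ?_
    simp only [Function.comp, chainTerm_one]
    rw [DecSeq.entry_oneEquiv]
  | succ n ih =>
    obtain ⟨K, hK0, hK⟩ := exists_rq_bound hq hq0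
    have h1 := ih fun j h1 hj => hw j h1 (by omega)
    have h2 := (hw (n + 2) (by omega) le_rfl).mul_right K
    have h3 := h1.mul_of_nonneg h2 (fun _ => norm_nonneg _)
      (fun _ => mul_nonneg (norm_nonneg _) hK0)
    have hinj : Function.Injective fun s : DecSeq (n + 2) lo =>
        ((s.init, ⟨s.entry (n + 2), s.le_entry (by omega) le_rfl⟩) :
          DecSeq (n + 1) lo × {k : ℤ // lo ≤ k}) := fun s s' h => by
      simp only [Prod.mk.injEq, Subtype.mk.injEq] at h
      refine DecSeq.ext_entry fun j h1 hj => ?_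
      rcases Nat.lt_or_ge (n + 1) j with h' | h'
      · obtain rfl : j = n + 2 := by omega
        exact h.2
      · rw [← s.entry_init h1 h', ← s'.entry_init h1 h', h.1]
    refine (h3.comp_injective hinj).of_nonneg_of_le (fun _ => norm_nonneg _) fun s => ?_
    simp only [Function.comp]
    rw [chainTerm_succ, norm_mul, norm_mul (w _ _)]
    exact mul_le_mul_of_nonneg_left (mul_le_mul_of_nonneg_left (hK _) (norm_nonneg _))
      (norm_nonneg _)

theorem summable_chainTerm_mul (hq : ‖q‖ < 1) (hq0 : q ≠ 0) (n : ℕ)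
    (hw : ∀ j, 1 ≤ j → j ≤ n + 1 → Summable fun k : {k : ℤ // lo ≤ k} => ‖w j k‖)
    {β : ℤ → ℂ} {K : ℝ} (hβ : ∀ k, lo ≤ k → ‖β k‖ ≤ K) :
    Summable fun s : DecSeq (n + 1) lo => chainTerm q w s * β (s.entry (n + 1)) := by
  refine Summable.of_norm (((summable_chainTerm hq hq0 n hw).mul_right K).of_nonneg_of_le
    (fun _ => norm_nonneg _) fun s => ?_)
  rw [norm_mul]
  exact mul_le_mul_of_nonneg_left (hβ _ (s.le_entry (by omega) le_rfl)) (norm_nonneg _)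

/-- Summing over the last entry, a finite sum bounded above by the previous entry, replaces β by β'.
-/
theorem hasSum_chainTerm_succ (hq : ‖q‖ < 1) (hq0 : q ≠ 0) (n : ℕ)
    (hw : ∀ j, 1 ≤ j → j ≤ n + 2 → Summable fun k : {k : ℤ // lo ≤ k} => ‖w j k‖)
    {β β' : ℤ → ℂ} {K : ℝ} (hβ : ∀ k, lo ≤ k → ‖β k‖ ≤ K)
    (hβ' : ∀ N, lo ≤ N → ∑ k ∈ Icc lo N, w (n + 2) k * rq q (N - k) * β k = β' N) {a : ℂ}
    (ha : HasSum (fun s : DecSeq (n + 1) lo => chainTerm q w s * β' (s.entry (n + 1))) a) :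
    HasSum (fun s : DecSeq (n + 2) lo => chainTerm q w s * β (s.entry (n + 2))) a := by
  rw [← (DecSeq.snocEquiv n lo).hasSum_iff]
  refine ha.sigma_of_hasSum (fun s => ?_)
    ((DecSeq.snocEquiv n lo).summable_iff.2 (summable_chainTerm_mul hq hq0 (n + 1) hw hβ))
  rw [← hβ' _ (s.le_entry (by omega) le_rfl), mul_sum, ← sum_coe_sort]
  convert hasSum_fintype _ using 2 with k
  have h1 := (DecSeq.snocEquiv n lo).left_inv ⟨s, k⟩
  have h2 : ((DecSeq.snocEquiv n lo) ⟨s, k⟩).init = s := congrArg Sigma.fst h1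
  have h3 : ((DecSeq.snocEquiv n lo) ⟨s, k⟩).entry (n + 2) = k :=
    DecSeq.entry_snocEquiv _
  simp only [Function.comp]
  rw [chainTerm_succ, h2, h3]
  ring

theorem norm_sum_Icc_le {w : ℤ → ℂ}
    (hw : Summable fun k : {k : ℤ // lo ≤ k} => ‖w k‖) (N : ℤ) :
    ∑ k ∈ Icc lo N, ‖w k‖ ≤ ∑' k : {k : ℤ // lo ≤ k}, ‖w k‖ := by
  have h := hw.sum_le_tsum ((Icc lo N).subtype (fun k => lo ≤ k)) (fun _ _ => norm_nonneg _)
  rwa [sum_subtype_of_mem (fun k => ‖w k‖) fun k hk => (mem_Icc.1 hk).1] at h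

theorem exists_bound_sum (hq : ‖q‖ < 1) (hq0 : q ≠ 0) {w : ℤ → ℂ}
    (hw : Summable fun k : {k : ℤ // lo ≤ k} => ‖w k‖) {β β' : ℤ → ℂ} {K : ℝ}
    (hβ : ∀ k, lo ≤ k → ‖β k‖ ≤ K)
    (hβ' : ∀ N, lo ≤ N → ∑ k ∈ Icc lo N, w k * rq q (N - k) * β k = β' N) :
    ∃ K', ∀ k, lo ≤ k → ‖β' k‖ ≤ K' := by
  obtain ⟨L, hL0, hL⟩ := exists_rq_bound hq hq0
  have hK0 : 0 ≤ K := (norm_nonneg _).trans (hβ lo le_rfl)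
  refine ⟨(∑' k : {k : ℤ // lo ≤ k}, ‖w k‖) * (L * K), fun N hN => ?_⟩
  rw [← hβ' N hN]
  refine (norm_sum_le _ _).trans ((sum_le_sum fun k hk => ?_).trans_eq
    (sum_mul (Icc lo N) (fun k => ‖w k‖) (L * K)).symm |>.trans
    (mul_le_mul_of_nonneg_right (norm_sum_Icc_le hw N) (mul_nonneg hL0 hK0)))
  rw [norm_mul, norm_mul, mul_assoc]
  exact mul_le_mul_of_nonneg_left (mul_le_mul (hL _) (hβ k (mem_Icc.1 hk).1) (norm_nonneg _) hL0)
    (norm_nonneg _)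

/-- The outermost variable carries no factor 1/(q)_{N-s_1}. It is recovered as the limit N → ∞,
where that factor tends to 1/(q)_∞; this accounts for `qInf q q` in the value. -/
theorem hasSum_of_tendsto_bailey (hq : ‖q‖ < 1) (hq0 : q ≠ 0) {w : ℤ → ℂ}
    (hw : Summable fun k : {k : ℤ // lo ≤ k} => ‖w k‖) {β β' : ℤ → ℂ} {K : ℝ}
    (hβ : ∀ k, lo ≤ k → ‖β k‖ ≤ K)
    (hβ' : ∀ N, lo ≤ N → ∑ k ∈ Icc lo N, w k * rq q (N - k) * β k = β' N) {G : ℂ}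
    (hG : Tendsto (fun n : ℕ => β' (lo + n)) atTop (𝓝 G)) :
    HasSum (fun k : {k : ℤ // lo ≤ k} => w k * β k) (qInf q q * G) := by
  obtain ⟨L, hL0, hL⟩ := exists_rq_bound hq hq0
  have hs : Summable fun k : {k : ℤ // lo ≤ k} => ‖w k * β k‖ := by
    refine (hw.mul_right K).of_nonneg_of_le (fun _ => norm_nonneg _) fun k => ?_
    rw [norm_mul]
    exact mul_le_mul_of_nonneg_left (hβ k k.2) (norm_nonneg _)
  have h1 : ∀ N, lo ≤ N →
      ∑' k : {k : ℤ // lo ≤ k}, w k * β k * rq q (N - k) = β' N := fun N hN => by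
    rw [← hβ' N hN, tsum_eq_sum (s := (Icc lo N).subtype fun k => lo ≤ k) fun k hk => by
      rw [mem_subtype, mem_Icc, not_and, not_le] at hk
      rw [rq_of_neg hq0 (by linarith [hk k.2]), mul_zero]]
    rw [sum_subtype_of_mem (fun k => w k * β k * rq q (N - k)) fun k hk => (mem_Icc.1 hk).1]
    exact sum_congr rfl fun k _ => by ring
  have l1 : Tendsto (fun n : ℕ => ∑' k : {k : ℤ // lo ≤ k}, w k * β k * rq q (lo + n - k)) atTop
      (𝓝 (∑' k : {k : ℤ // lo ≤ k}, w k * β k * (qInf q q)⁻¹)) := by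
    refine tendsto_tsum_of_dominated_convergence (hs.mul_right L) (fun k => ?_)
      (Eventually.of_forall fun n k => ?_)
    · refine Tendsto.const_mul _ ((tendsto_rq hq (lo - k)).congr fun n => ?_)
      congr 1; ring
    · rw [norm_mul]
      exact mul_le_mul_of_nonneg_left (hL _) (norm_nonneg _)
  have h2 := tendsto_nhds_unique (l1.congr fun n => h1 _ (by omega)) hG
  rw [← h2, tsum_mul_right, mul_comm, mul_assoc, inv_mul_cancel₀ (qInf_self_ne_zero hq), mul_one]
  exact hs.of_norm.hasSum

/-- Evaluation of the multi-sum by iterating Bailey's lemma from the innermost variable. -/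
theorem hasSum_chainTerm (hq : ‖q‖ < 1) (hq0 : q ≠ 0) (n : ℕ)
    (hw : ∀ j, 1 ≤ j → j ≤ n + 1 → Summable fun k : {k : ℤ // lo ≤ k} => ‖w j k‖)
    {b : ℕ → ℤ → ℂ} {K : ℝ} (hb : ∀ k, lo ≤ k → ‖b (n + 1) k‖ ≤ K)
    (hstep : ∀ j, j ≤ n → ∀ N, lo ≤ N →
      ∑ k ∈ Icc lo N, w (j + 1) k * rq q (N - k) * b (j + 1) k = b j N) {G : ℂ}
    (hG : Tendsto (fun n : ℕ => b 0 (lo + n)) atTop (𝓝 G)) :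
    HasSum (fun s : DecSeq (n + 1) lo => chainTerm q w s * b (n + 1) (s.entry (n + 1)))
      (qInf q q * G) := by
  induction n generalizing K with
  | zero =>
    rw [← (DecSeq.oneEquiv lo).hasSum_iff]
    convert hasSum_of_tendsto_bailey hq hq0 (hw 1 le_rfl le_rfl) hb (hstep 0 le_rfl) hG using 2
      with k
    simp only [Function.comp, chainTerm_one]
    rw [DecSeq.entry_oneEquiv]
  | succ n ih =>
    obtain ⟨K', hK'⟩ := exists_bound_sum hq hq0 (hw (n + 2) (by omega) le_rfl) hb
      (hstep (n + 1) le_rfl)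
    exact hasSum_chainTerm_succ hq hq0 n hw hb (hstep (n + 1) le_rfl)
      (ih (fun j h1 hj => hw j h1 (by omega)) hK' fun j hj => hstep j (by omega))

/-- Fubini between the multi-sum and the expansion of its inner factor. The common value V is left
open, to be computed on the bilateral side. -/
theorem hasSum_chainTerm_of_expansion (hq : ‖q‖ < 1) (hq0 : q ≠ 0) (n : ℕ)
    (hw : ∀ j, 1 ≤ j → j ≤ n + 1 → Summable fun k : {k : ℤ // lo ≤ k} => ‖w j k‖)
    {c X : ℤ → ℂ} {D : ℤ → ℤ → ℂ} {β : ℤ → ℂ} {K : ℝ} (hc : Summable fun r => ‖c r‖)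
    (hD : ∀ r k, ‖D r k‖ ≤ K)
    (hβ : ∀ k, lo ≤ k → HasSum (fun r => c r * D r k) (β k))
    (hX : ∀ r, HasSum (fun s : DecSeq (n + 1) lo => chainTerm q w s * D r (s.entry (n + 1))) (X r)) :
    ∃ V, HasSum (fun r => c r * X r) V ∧
      HasSum (fun s : DecSeq (n + 1) lo => chainTerm q w s * β (s.entry (n + 1))) V := by
  have hs : Summable fun p : DecSeq (n + 1) lo × ℤ =>
      chainTerm q w p.1 * (c p.2 * D p.2 (p.1.entry (n + 1))) := by
    have h1 := ((summable_chainTerm hq hq0 n hw).mul_of_nonneg hc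
      (fun _ => norm_nonneg _) fun _ => norm_nonneg _).mul_right K
    refine Summable.of_norm (h1.of_nonneg_of_le (fun _ => norm_nonneg _) fun p => ?_)
    rw [norm_mul, norm_mul, ← mul_assoc]
    exact mul_le_mul_of_nonneg_left (hD _ _) (mul_nonneg (norm_nonneg _) (norm_nonneg _))
  have h1 := hs.hasSum.prod_fiberwise
    fun s => (hβ _ (s.le_entry (by omega) le_rfl)).mul_left (chainTerm q w s)
  have h2 := ((Equiv.prodComm ℤ (DecSeq (n + 1) lo)).hasSum_iff.2 hs.hasSum).prod_fiberwise
    (g := fun r => c r * X r) fun r => by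
      have h3 := (hX r).mul_left (c r)
      simp only [mul_left_comm (c r)] at h3
      exact h3
  exact ⟨_, h2, h1⟩

end Chain

/-! ### The individual Bailey steps -/

section Steps

variable {t q : ℂ}

theorem sq_ne_zero_of_eq (ht0 : t ≠ 0) (h : t ^ 2 = q) : q ≠ 0 := h ▸ pow_ne_zero 2 ht0

theorem norm_sq_lt_one (ht : ‖t‖ < 1) (h : t ^ 2 = q) : ‖q‖ < 1 := by
  rw [← h, norm_pow]; exact pow_lt_one₀ (norm_nonneg _) ht two_ne_zero

theorem zpow_eq_zpow_two_mul (h : t ^ 2 = q) (k : ℤ) : q ^ k = t ^ (2 * k) := by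
  rw [← h, zpow_mul]; norm_cast

theorem norm_zpow_lt_one (ht : ‖t‖ < 1) {k : ℤ} (hk : 0 < k) : ‖t ^ k‖ < 1 := by
  lift k to ℕ using hk.le
  rw [zpow_natCast, norm_pow]
  exact pow_lt_one₀ (norm_nonneg _) ht (by omega)

theorem one_add_zpow_ne_zero (ht : ‖t‖ < 1) (k : ℤ) : 1 + t ^ k ≠ 0 := by
  intro h0
  have h1 : t ^ k = -1 := (neg_eq_of_add_eq_zero_right h0).symm
  rcases lt_trichotomy k 0 with hk | rfl | hk
  · have := norm_zpow_lt_one ht (Int.neg_pos_of_neg hk)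
    rw [zpow_neg, h1] at this
    norm_num at this
  · norm_num at h1
  · have := norm_zpow_lt_one ht hk
    rw [h1] at this
    norm_num at this

theorem neg_pow_mul_zpow_ne_one (ht : ‖t‖ < 1) (ht0 : t ≠ 0) (h : t ^ 2 = q) (m : ℕ) (k : ℤ) :
    -t ^ m * q ^ k ≠ 1 := by
  rw [zpow_eq_zpow_two_mul h, ← zpow_natCast, neg_mul, ← zpow_add₀ ht0]
  intro h1
  refine one_add_zpow_ne_zero ht (m + 2 * k) ?_
  rw [← h1]; ring

theorem neg_mul_pow_mul_zpow_ne_one (ht : ‖t‖ < 1) (ht0 : t ≠ 0) (h : t ^ 2 = q) (m : ℕ)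
    (k : ℤ) : -(q * t ^ m) * q ^ k ≠ 1 := by
  have := neg_pow_mul_zpow_ne_one ht ht0 h m (k + 1)
  rwa [zpow_add_one₀ (sq_ne_zero_of_eq ht0 h), show -t ^ m * (q ^ k * q) = -(q * t ^ m) * q ^ k by
    ring] at this

theorem qPoch_mul_one_add (ht : ‖t‖ < 1) (ht0 : t ≠ 0) (h : t ^ 2 = q) (m : ℕ) (k : ℤ) :
    qPoch (-t ^ m) q k * (1 + t ^ (m + 2 * k)) = (1 + t ^ m) * qPoch (-(q * t ^ m)) q k := by
  have hq := norm_sq_lt_one ht h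
  have hq0 := sq_ne_zero_of_eq ht0 h
  unfold qPoch
  have e : -t ^ m * q ^ k = -t ^ (m + 2 * k) := by
    rw [zpow_eq_zpow_two_mul h, ← zpow_natCast, zpow_add₀ ht0]; ring
  have h1 : qInf (-t ^ m) q = (1 + t ^ m) * qInf (-(q * t ^ m)) q := by
    rw [qInf_eq_mul hq, sub_neg_eq_add]; congr 2; ring
  have h2 : qInf (-t ^ m * q ^ k) q
      = (1 + t ^ (m + 2 * k)) * qInf (-(q * t ^ m) * q ^ k) q := by
    rw [qInf_eq_mul hq, e, sub_neg_eq_add, ← e]; congr 2; ring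
  have h3 := one_add_zpow_ne_zero ht (m + 2 * k)
  rw [h1, h2]
  generalize qInf (-(q * t ^ m) * q ^ k) q = x
  by_cases h4 : x = 0
  · simp [h4]
  · field_simp

/-- The kernel relative to `q^(m-1)` that arises from the kernel relative to `q^m`. -/
theorem baileyKer_pred (ht : ‖t‖ < 1) (ht0 : t ≠ 0) (h : t ^ 2 = q) (m r n : ℤ) :
    baileyKer q (m - 1) (r + 1) n = (1 - q ^ (n - r)) * baileyKer q m r n := by
  have := rq_succ (norm_sq_lt_one ht h) (sq_ne_zero_of_eq ht0 h) (n - r - 1)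
  rw [sub_add_cancel] at this
  unfold baileyKer
  rw [show n - (r + 1) = n - r - 1 by ring, this, show m - 1 + n + (r + 1) = m + n + r by ring]
  ring

theorem sum_bailey_quadratic (ht : ‖t‖ < 1) (ht0 : t ≠ 0) (h : t ^ 2 = q) {a lo : ℤ}
    (hlo : 2 * lo ≤ 1 - a) (r n : ℤ) :
    ∑ k ∈ Icc lo n, t ^ (2 * k ^ 2 + 2 * a * k) * rq q (n - k) * baileyKer q a r k
      = t ^ (2 * r ^ 2 + 2 * a * r) * baileyKer q a r n := by
  have := sum_bailey (norm_sq_lt_one ht h) (sq_ne_zero_of_eq ht0 h) (ε := 0)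
    (w := fun k => t ^ (2 * k ^ 2 + 2 * a * k)) (g := fun _ => 1)
    (v := fun k => t ^ (2 * k ^ 2 + 2 * a * k)) hlo
    (fun k _ => by
      rw [sub_zero, zpow_eq_zpow_two_mul h, zpow_eq_zpow_two_mul h, ← zpow_add₀ ht0,
        ← zpow_add₀ ht0]
      congr 1; ring) (by simp) (by simp) (fun k => by congr 1; ring) r n
  simpa using this

/-- The weight fits q^{m-1}, not q^m. Split 1 = q^{k-r} + (1-q^{k-r}): the first part restores the
weight for q^m, and the second turns the kernel into the one relative to q^{m-1} at r+1. -/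
theorem sum_bailey_quadratic_pred (ht : ‖t‖ < 1) (ht0 : t ≠ 0) (h : t ^ 2 = q) {m lo : ℤ}
    (hlo : 2 * lo ≤ 1 - m) (r n : ℤ) :
    ∑ k ∈ Icc lo n, t ^ (2 * k ^ 2 + 2 * (m - 1) * k) * rq q (n - k) * baileyKer q m r k
      = t ^ (2 * r ^ 2 + 2 * (m - 1) * r) *
        (baileyKer q m r n + t ^ (2 * m + 4 * r) * baileyKer q (m - 1) (r + 1) n) := by
  have h1 := sum_bailey_quadratic ht ht0 h hlo r n
  have h2 := sum_bailey_quadratic ht ht0 h (a := m - 1) (lo := lo) (by omega) (r + 1) n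
  calc _ = ∑ k ∈ Icc lo n, (t ^ (-(2 * r)) *
          (t ^ (2 * k ^ 2 + 2 * m * k) * rq q (n - k) * baileyKer q m r k) +
          t ^ (2 * k ^ 2 + 2 * (m - 1) * k) * rq q (n - k) * baileyKer q (m - 1) (r + 1) k) := by
        refine sum_congr rfl fun k _ => ?_
        have e : t ^ (-(2 * r)) * t ^ (2 * k ^ 2 + 2 * m * k)
            = t ^ (2 * k ^ 2 + 2 * (m - 1) * k) * q ^ (k - r) := by
          rw [zpow_eq_zpow_two_mul h, ← zpow_add₀ ht0, ← zpow_add₀ ht0]; congr 1; ring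
        rw [baileyKer_pred ht ht0 h]
        linear_combination (-rq q (n - k) * baileyKer q m r k) * e
    _ = _ := by
        rw [sum_add_distrib, ← mul_sum, h1, h2]
        have e1 : t ^ (-(2 * r)) * t ^ (2 * r ^ 2 + 2 * m * r)
            = t ^ (2 * r ^ 2 + 2 * (m - 1) * r) := by
          rw [← zpow_add₀ ht0]; congr 1; ring
        have e2 : t ^ (2 * (r + 1) ^ 2 + 2 * (m - 1) * (r + 1))
            = t ^ (2 * r ^ 2 + 2 * (m - 1) * r) * t ^ (2 * m + 4 * r) := by
          rw [← zpow_add₀ ht0]; congr 1; ring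
        rw [e2, ← mul_assoc, e1]; ring

/-- The combination of kernels produced by `κ` steps that shift `m` to `m - 1`. -/
noncomputable def mixedKer (t q : ℂ) (m : ℤ) (κ : ℕ) (r n : ℤ) : ℂ :=
  baileyKer q m r n
    + (∑ x ∈ range κ, (t ^ (2 * m + 4 * r)) ^ (x + 1)) * baileyKer q (m - 1) (r + 1) n

theorem mixedKer_zero (m r n : ℤ) : mixedKer t q m 0 r n = baileyKer q m r n := by
  simp [mixedKer]

/-- The q^{m-1} part at r+1 has the eigenvalue of the q^m part times t^{2m+4r}; hence the geometric
sum is shifted by one power and gains a new first term. -/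
theorem sum_mixedKer (ht : ‖t‖ < 1) (ht0 : t ≠ 0) (h : t ^ 2 = q) {m lo : ℤ}
    (hlo : 2 * lo ≤ 1 - m) (κ : ℕ) (r n : ℤ) :
    ∑ k ∈ Icc lo n, t ^ (2 * k ^ 2 + 2 * (m - 1) * k) * rq q (n - k) * mixedKer t q m κ r k
      = t ^ (2 * r ^ 2 + 2 * (m - 1) * r) * mixedKer t q m (κ + 1) r n := by
  have h1 := sum_bailey_quadratic_pred ht ht0 h hlo r n
  have h2 := sum_bailey_quadratic ht ht0 h (a := m - 1) (lo := lo) (by omega) (r + 1) n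
  unfold mixedKer
  simp only [mul_add, sum_add_distrib]
  simp only [mul_left_comm _ (∑ x ∈ range κ, (t ^ (2 * m + 4 * r)) ^ (x + 1))]
  rw [h1, ← mul_sum, h2, show 2 * (r + 1) ^ 2 + 2 * (m - 1) * (r + 1)
    = (2 * r ^ 2 + 2 * (m - 1) * r) + (2 * m + 4 * r) by ring, zpow_add₀ ht0 (2 * r ^ 2 + _),
    sum_range_succ']
  have e : ∑ x ∈ range κ, (t ^ (2 * m + 4 * r)) ^ (x + 1 + 1)
      = t ^ (2 * m + 4 * r) * ∑ x ∈ range κ, (t ^ (2 * m + 4 * r)) ^ (x + 1) := by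
    rw [mul_sum]; exact sum_congr rfl fun x _ => pow_succ' _ _
  rw [e]
  ring

/-- The eigenvalue of the weight `(-q^(m/2))_k q^((k²+k+mk)/2)`. -/
noncomputable def halfEig (t : ℂ) (m r : ℤ) : ℂ :=
  t ^ (r ^ 2 + r + m * r) * (1 + t ^ m) / (1 + t ^ (m + 2 * r))

/-- Bailey's lemma with ε = -q^{1+m/2}. The denominator of `halfEig` comes from (-q^{m/2})_k /
(-q^{1+m/2})_k = (1+q^{m/2}) / (1+q^{k+m/2}). -/
theorem sum_bailey_half (ht : ‖t‖ < 1) (ht0 : t ≠ 0) (h : t ^ 2 = q) (m : ℕ) {lo : ℤ}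
    (hlo : 2 * lo ≤ 1 - m) (r n : ℤ) :
    ∑ k ∈ Icc lo n, qPoch (-t ^ m) q k * t ^ (k ^ 2 + k + m * k) * rq q (n - k) * baileyKer q m r k
      = halfEig t m r * qPoch (-(q * t ^ m)) q n * baileyKer q m r n := by
  have hq := norm_sq_lt_one ht h
  have hq0 := sq_ne_zero_of_eq ht0 h
  refine sum_bailey hq hq0 (ε := -(q * t ^ m))
    (w := fun k => qPoch (-t ^ m) q k * t ^ (k ^ 2 + k + m * k)) (v := halfEig t m) hlo
    (fun k _ => ?_) (fun k _ => ?_) (fun k _ => ?_) (fun k => ?_) r n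
  · rw [qPoch_succ hq hq0 _ (neg_pow_mul_zpow_ne_one ht ht0 h m k)]
    have e1 : t ^ ((k + 1) ^ 2 + (k + 1) + (m : ℤ) * (k + 1))
        = t ^ (k ^ 2 + k + m * k) * (q ^ k * q * t ^ m) := by
      rw [← zpow_add_one₀ hq0, zpow_eq_zpow_two_mul h, ← zpow_natCast, ← zpow_add₀ ht0,
        ← zpow_add₀ ht0]
      congr 1; ring
    have e2 : q ^ ((m : ℤ) + k + 1) = t ^ m * t ^ m * q ^ k * q := by
      rw [zpow_add_one₀ hq0, zpow_add₀ hq0, zpow_natCast, ← h]; ring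
    rw [e1, e2]; ring
  · exact qPoch_succ hq hq0 _ (neg_mul_pow_mul_zpow_ne_one ht ht0 h m k)
  · have h3 := one_add_zpow_ne_zero ht (m + 2 * k)
    have h4 := qPoch_mul_one_add ht ht0 h m k
    simp only [halfEig, zpow_natCast]
    rw [div_mul_eq_mul_div, div_eq_iff h3]
    linear_combination (-t ^ (k ^ 2 + k + m * k)) * h4
  · simp only [halfEig]
    rw [div_eq_div_iff (one_add_zpow_ne_zero ht _) (one_add_zpow_ne_zero ht _)]
    have e1 : t ^ ((-(m : ℤ) - k) ^ 2 + (-(m : ℤ) - k) + m * (-(m : ℤ) - k))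
        = t ^ (k ^ 2 + k + m * k) * t ^ (m + 2 * (-(m : ℤ) - k)) := by
      rw [← zpow_add₀ ht0]; congr 1; ring
    have e2 : t ^ (m + 2 * (-(m : ℤ) - k)) * t ^ (m + 2 * k) = 1 := by
      rw [← zpow_add₀ ht0, ← zpow_zero t]; congr 1; ring
    rw [e1]
    linear_combination (t ^ (k ^ 2 + k + m * k) * (1 + t ^ (m : ℤ))) * e2

/-- Relative to q^{m-1} the choice ε = -q^{m/2} makes (-q^{m/2})_k itself the factor g, so the
eigenvalue is a pure power with no denominator. -/
theorem sum_bailey_half_pred (ht : ‖t‖ < 1) (ht0 : t ≠ 0) (h : t ^ 2 = q) (m : ℕ) {lo : ℤ}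
    (hlo : 2 * lo ≤ 2 - m) (r n : ℤ) :
    ∑ k ∈ Icc lo n, qPoch (-t ^ m) q k * t ^ (k ^ 2 + (m - 1) * k) * rq q (n - k) *
        baileyKer q (m - 1) r k
      = t ^ (r ^ 2 + (m - 1) * r) * qPoch (-t ^ m) q n * baileyKer q (m - 1) r n := by
  have hq := norm_sq_lt_one ht h
  have hq0 := sq_ne_zero_of_eq ht0 h
  refine sum_bailey hq hq0 (ε := -t ^ m)
    (w := fun k => qPoch (-t ^ m) q k * t ^ (k ^ 2 + (m - 1) * k))
    (v := fun r => t ^ (r ^ 2 + (m - 1) * r)) (by omega)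
    (fun k _ => ?_) (fun k _ => ?_) (fun k _ => mul_comm _ _) (fun k => ?_) r n
  · rw [qPoch_succ hq hq0 _ (neg_pow_mul_zpow_ne_one ht ht0 h m k)]
    have e1 : t ^ ((k + 1) ^ 2 + ((m : ℤ) - 1) * (k + 1))
        = t ^ (k ^ 2 + (m - 1) * k) * (q ^ k * t ^ m) := by
      rw [zpow_eq_zpow_two_mul h, ← zpow_natCast, ← zpow_add₀ ht0, ← zpow_add₀ ht0]
      congr 1; ring
    have e2 : q ^ ((m : ℤ) - 1 + k + 1) = t ^ m * t ^ m * q ^ k := by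
      rw [show (m : ℤ) - 1 + k + 1 = m + k by ring, zpow_add₀ hq0, zpow_natCast, ← h]; ring
    rw [e1, e2]; ring
  · exact qPoch_succ hq hq0 _ (neg_pow_mul_zpow_ne_one ht ht0 h m k)
  · congr 1; ring

/-- The outermost step of the second multi-sum for i ≥ 1: the splitting 1 = q^{k-r} + (1-q^{k-r})
again, now with the half-weight steps relative to q^m and q^{m-1}. -/
theorem sum_mixedKer_half (ht : ‖t‖ < 1) (ht0 : t ≠ 0) (h : t ^ 2 = q) (m : ℕ) {lo : ℤ}
    (hlo : 2 * lo ≤ 1 - m) (κ : ℕ) (r n : ℤ) :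
    ∑ k ∈ Icc lo n, qPoch (-t ^ m) q k * t ^ (k ^ 2 + (m - 1) * k) * rq q (n - k) *
        mixedKer t q m κ r k
      = t ^ (-(2 * r)) * (halfEig t m r * qPoch (-(q * t ^ m)) q n * baileyKer q m r n)
        + (∑ x ∈ range (κ + 1), (t ^ (2 * m + 4 * r : ℤ)) ^ x) *
          (t ^ ((r + 1) ^ 2 + (m - 1) * (r + 1)) * qPoch (-t ^ m) q n *
            baileyKer q (m - 1) (r + 1) n) := by
  have h1 := sum_bailey_half ht ht0 h m hlo r n
  have h2 := sum_bailey_half_pred ht ht0 h m (lo := lo) (by omega) (r + 1) n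
  rw [← h1, ← h2, mul_sum, mul_sum, ← sum_add_distrib]
  refine sum_congr rfl fun k _ => ?_
  have e : t ^ (-(2 * r)) * t ^ (k ^ 2 + k + m * k)
      = t ^ (k ^ 2 + ((m : ℤ) - 1) * k) * q ^ (k - r) := by
    rw [zpow_eq_zpow_two_mul h, ← zpow_add₀ ht0, ← zpow_add₀ ht0]; congr 1; ring
  have e2 := baileyKer_pred ht ht0 h m r k
  rw [sum_range_succ', pow_zero, mixedKer]
  linear_combination (-rq q (n - k) * baileyKer q m r k * qPoch (-t ^ m) q k) * e
    - (rq q (n - k) * qPoch (-t ^ m) q k * t ^ (k ^ 2 + ((m : ℤ) - 1) * k)) * e2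

theorem exists_baileyKer_bound (ht : ‖t‖ < 1) (ht0 : t ≠ 0) (h : t ^ 2 = q) (a : ℤ) :
    ∃ K, ∀ r k, ‖baileyKer q a r k‖ ≤ K := by
  obtain ⟨K, hK0, hK⟩ := exists_rq_bound (norm_sq_lt_one ht h) (sq_ne_zero_of_eq ht0 h)
  exact ⟨K * K, fun r k => by
    rw [baileyKer, norm_mul]
    exact mul_le_mul (hK _) (hK _) (norm_nonneg _) hK0⟩

theorem tendsto_baileyKer (ht : ‖t‖ < 1) (h : t ^ 2 = q) (a r lo : ℤ) :
    Tendsto (fun n : ℕ => baileyKer q a r (lo + n)) atTop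
      (𝓝 ((qInf q q)⁻¹ * (qInf q q)⁻¹)) := by
  have hq := norm_sq_lt_one ht h
  refine ((tendsto_rq hq (lo - r)).mul (tendsto_rq hq (a + lo + r))).congr fun n => ?_
  unfold baileyKer
  congr 2 <;> ring

end Steps

/-! ### The multi-sums with the seed replaced by one kernel -/

section Multisums

variable {t q : ℂ}

theorem summable_subtype_mul {lo : ℤ} {f g : ℤ → ℂ} {K : ℝ} (hf : ∀ k, lo ≤ k → ‖f k‖ ≤ K)
    (hg : Summable fun k => ‖g k‖) : Summable fun k : {k : ℤ // lo ≤ k} => ‖f k * g k‖ := by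
  refine ((hg.comp_injective (Subtype.val_injective (p := fun k : ℤ => lo ≤ k))).mul_left
    K).of_nonneg_of_le (fun _ => norm_nonneg _) fun k => ?_
  rw [norm_mul]
  exact mul_le_mul_of_nonneg_right (hf k k.2) (norm_nonneg _)

/-- The Gaussian weight `q^(k²+mk-k)` for `j ≤ i` and `q^(k²+mk)` for `j > i`. -/
noncomputable def coreWeight (t : ℂ) (m i j : ℕ) (k : ℤ) : ℂ :=
  t ^ (2 * k ^ 2 + 2 * m * k - if j ≤ i then 2 * k else 0)

theorem summable_coreWeight (ht : ‖t‖ < 1) (ht0 : t ≠ 0) (m i j : ℕ) :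
    Summable fun k => ‖coreWeight t m i j k‖ := by
  unfold coreWeight
  split_ifs
  · refine (summable_norm_zpow_quadratic ht ht0 (A := 2) (by norm_num) (2 * m - 2)).congr
      fun k => ?_
    congr 2; ring
  · refine (summable_norm_zpow_quadratic ht ht0 (A := 2) (by norm_num) (2 * m)).congr
      fun k => ?_
    congr 2; ring

/-- The factor collected when Bailey's lemma is applied to the variables `s_R, …, s_{j+1}`. -/
noncomputable def coreFactor (t : ℂ) (m i R j : ℕ) (ρ : ℤ) : ℂ :=
  (t ^ (2 * ρ ^ 2 + 2 * m * ρ)) ^ (R - max i j) * (t ^ (2 * ρ ^ 2 + 2 * (m - 1) * ρ)) ^ (i - j)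

/-- For j ≥ i the truncated difference i - j is 0 and the mixed kernel is the plain one; once j + 1
≤ i, each step lengthens its geometric sum. -/
theorem sum_coreWeight (ht : ‖t‖ < 1) (ht0 : t ≠ 0) (h : t ^ 2 = q) {m i R j : ℕ} {lo : ℤ}
    (hlo : 2 * lo ≤ 1 - m) (hj : j + 1 ≤ R) (ρ n : ℤ) :
    ∑ k ∈ Icc lo n, coreWeight t m i (j + 1) k * rq q (n - k) *
        (coreFactor t m i R (j + 1) ρ * mixedKer t q m (i - (j + 1)) ρ k)
      = coreFactor t m i R j ρ * mixedKer t q m (i - j) ρ n := by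
  unfold coreWeight coreFactor
  by_cases hc : j + 1 ≤ i
  · simp only [if_pos hc]
    have h1 := sum_mixedKer ht ht0 h hlo (i - (j + 1)) ρ n
    rw [show i - (j + 1) + 1 = i - j by omega] at h1
    rw [max_eq_left hc, max_eq_left (by omega : j ≤ i)]
    generalize t ^ (2 * ρ ^ 2 + 2 * (m : ℤ) * ρ) = u
    generalize t ^ (2 * ρ ^ 2 + 2 * ((m : ℤ) - 1) * ρ) = v at h1 ⊢
    rw [show v ^ (i - j) = v ^ (i - (j + 1)) * v by rw [← pow_succ]; congr 1; omega,
      show u ^ (R - i) * (v ^ (i - (j + 1)) * v) * mixedKer t q m (i - j) ρ n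
        = u ^ (R - i) * v ^ (i - (j + 1)) * (v * mixedKer t q m (i - j) ρ n) by ring, ← h1, mul_sum]
    refine sum_congr rfl fun k _ => ?_
    rw [show 2 * k ^ 2 + 2 * (m : ℤ) * k - 2 * k = 2 * k ^ 2 + 2 * (m - 1) * k by ring]
    ring
  · simp only [if_neg hc, sub_zero]
    have h1 := sum_bailey_quadratic ht ht0 h (a := m) hlo ρ n
    rw [show i - (j + 1) = 0 by omega, show i - j = 0 by omega, max_eq_right (by omega),
      max_eq_right (by omega)]
    simp only [mixedKer_zero, pow_zero, mul_one]
    generalize t ^ (2 * ρ ^ 2 + 2 * (m : ℤ) * ρ) = u at h1 ⊢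
    rw [show u ^ (R - j) = u ^ (R - (j + 1)) * u by rw [← pow_succ]; congr 1; omega, mul_assoc,
      ← h1, mul_sum]
    refine sum_congr rfl fun k _ => ?_
    ring

/-- Both kernels have the same limit, so their coefficients merge into 1 + y² + … + y^{2κ} with y =
t^{2ρ+m}; in the first identity this is the source of the sum over k. -/
theorem tendsto_mixedKer (ht : ‖t‖ < 1) (h : t ^ 2 = q) (m : ℤ) (κ : ℕ) (ρ lo : ℤ) :
    Tendsto (fun n : ℕ => mixedKer t q m κ ρ (lo + n)) atTop
      (𝓝 ((∑ x ∈ range (κ + 1), (t ^ (2 * m + 4 * ρ)) ^ x) *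
        ((qInf q q)⁻¹ * (qInf q q)⁻¹))) := by
  have := (tendsto_baileyKer ht h m ρ lo).add ((tendsto_baileyKer ht h (m - 1) (ρ + 1) lo).const_mul
    (∑ x ∈ range κ, (t ^ (2 * m + 4 * ρ)) ^ (x + 1)))
  rw [← one_add_mul, ← pow_zero (t ^ (2 * m + 4 * ρ)), add_comm (_ ^ 0), ← sum_range_succ'] at this
  exact this

/-- The weights of the first multi-sum with `p + 2` variables. -/
noncomputable def weightB (t q : ℂ) (m p i j : ℕ) (k : ℤ) : ℂ :=
  if j = p + 2 then qPoch (-t ^ m) q k * t ^ (k ^ 2 + k + m * k)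
  else (if j = p + 1 then (qPoch (-(q * t ^ m)) q k)⁻¹ else 1) * coreWeight t m i j k

/-- The weights of the second multi-sum. -/
noncomputable def weightC (t q : ℂ) (m i j : ℕ) (k : ℤ) : ℂ :=
  if j = 1 then qPoch (-t ^ m) q k * t ^ (k ^ 2 + k + m * k - if 1 ≤ i then 2 * k else 0)
  else coreWeight t m i j k

theorem qInf_neg_mul_pow_ne_zero (ht : ‖t‖ < 1) (ht0 : t ≠ 0) (h : t ^ 2 = q) (m : ℕ) :
    qInf (-(q * t ^ m)) q ≠ 0 :=
  qInf_ne_zero (norm_sq_lt_one ht h) fun j => by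
    have := neg_mul_pow_mul_zpow_ne_one ht ht0 h m j
    rwa [zpow_natCast] at this

theorem summable_weightB (ht : ‖t‖ < 1) (ht0 : t ≠ 0) (h : t ^ 2 = q) (m p i j : ℕ) (lo : ℤ) :
    Summable fun k : {k : ℤ // lo ≤ k} => ‖weightB t q m p i j k‖ := by
  have hq := norm_sq_lt_one ht h
  have hq0 := sq_ne_zero_of_eq ht0 h
  unfold weightB
  split_ifs
  · obtain ⟨K, -, hK⟩ := exists_qPoch_bound hq hq0 (-t ^ m) lo
      fun k _ => neg_pow_mul_zpow_ne_one ht ht0 h m k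
    refine summable_subtype_mul (g := fun k => t ^ (k ^ 2 + k + (m : ℤ) * k)) hK ?_
    refine (summable_norm_zpow_quadratic ht ht0 (A := 1) le_rfl (m + 1)).congr fun k => ?_
    congr 2; ring
  · obtain ⟨K, -, hK⟩ := exists_qPoch_inv_bound hq hq0 (-(q * t ^ m)) lo
      (fun k _ => neg_mul_pow_mul_zpow_ne_one ht ht0 h m k) (qInf_neg_mul_pow_ne_zero ht ht0 h m)
    exact summable_subtype_mul (f := fun k => (qPoch (-(q * t ^ m)) q k)⁻¹) hK
      (summable_coreWeight ht ht0 m i j)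
  · exact summable_subtype_mul (f := fun _ => 1) (K := 1) (by simp)
      (summable_coreWeight ht ht0 m i j)

theorem summable_weightC (ht : ‖t‖ < 1) (ht0 : t ≠ 0) (h : t ^ 2 = q) (m i j : ℕ) (lo : ℤ) :
    Summable fun k : {k : ℤ // lo ≤ k} => ‖weightC t q m i j k‖ := by
  have hq := norm_sq_lt_one ht h
  have hq0 := sq_ne_zero_of_eq ht0 h
  unfold weightC
  split_ifs with hj hi
  · obtain ⟨K, -, hK⟩ := exists_qPoch_bound hq hq0 (-t ^ m) lo
      fun k _ => neg_pow_mul_zpow_ne_one ht ht0 h m k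
    refine summable_subtype_mul (g := fun k => t ^ (k ^ 2 + k + (m : ℤ) * k - 2 * k)) hK ?_
    refine (summable_norm_zpow_quadratic ht ht0 (A := 1) le_rfl (m - 1)).congr fun k => ?_
    congr 2; ring
  · obtain ⟨K, -, hK⟩ := exists_qPoch_bound hq hq0 (-t ^ m) lo
      fun k _ => neg_pow_mul_zpow_ne_one ht ht0 h m k
    refine summable_subtype_mul (g := fun k => t ^ (k ^ 2 + k + (m : ℤ) * k - 0)) hK ?_
    refine (summable_norm_zpow_quadratic ht ht0 (A := 1) le_rfl (m + 1)).congr fun k => ?_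
    congr 2; ring
  · have := summable_subtype_mul (f := fun _ => 1) (K := 1) (lo := lo) (by simp)
      (summable_coreWeight ht ht0 m i j)
    simpa using this

theorem qPoch_ne_zero (ht : ‖t‖ < 1) (ht0 : t ≠ 0) (h : t ^ 2 = q) (m : ℕ) (k : ℤ) :
    qPoch (-(q * t ^ m)) q k ≠ 0 := by
  refine div_ne_zero (qInf_neg_mul_pow_ne_zero ht ht0 h m)
    (qInf_ne_zero (norm_sq_lt_one ht h) fun j => ?_)
  have := neg_mul_pow_mul_zpow_ne_one ht ht0 h m (k + j)
  rwa [zpow_add₀ (sq_ne_zero_of_eq ht0 h), zpow_natCast, ← mul_assoc] at this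

/-- The first multi-sum with the seed replaced by one kernel. -/
theorem hasSum_weightB (ht : ‖t‖ < 1) (ht0 : t ≠ 0) (h : t ^ 2 = q) {m p i : ℕ} {lo : ℤ}
    (hlo : 2 * lo ≤ 1 - m) (hi : i ≤ p + 1) (ρ : ℤ) :
    HasSum (fun s : DecSeq (p + 2) lo =>
        chainTerm q (weightB t q m p i) s * baileyKer q m ρ (s.entry (p + 2)))
      ((qInf q q)⁻¹ * (halfEig t m ρ * coreFactor t m i (p + 1) 0 ρ *
        ∑ x ∈ range (i + 1), (t ^ (2 * m + 4 * ρ : ℤ)) ^ x)) := by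
  have hq := norm_sq_lt_one ht h
  have hq0 := sq_ne_zero_of_eq ht0 h
  obtain ⟨K, hK⟩ := exists_baileyKer_bound ht ht0 h m
  -- `b j N` is the result of summing over s_{p+2}, …, s_{j+1}, as a function of N = s_j.
  set b : ℕ → ℤ → ℂ := fun j N => if j = p + 2 then baileyKer q m ρ N else
    (if j = p + 1 then qPoch (-(q * t ^ m)) q N else 1) *
      (halfEig t m ρ * (coreFactor t m i (p + 1) j ρ * mixedKer t q m (i - j) ρ N)) with hb
  have key := hasSum_chainTerm hq hq0 (p + 1) (w := weightB t q m p i) (lo := lo)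
    (fun j _ _ => summable_weightB ht ht0 h m p i j lo) (b := b) (K := K)
    (fun k _ => by simpa [hb] using hK ρ k) (fun j hj N hN => ?_)
    (G := halfEig t m ρ * (coreFactor t m i (p + 1) 0 ρ *
      ((∑ x ∈ range (i + 1), (t ^ (2 * m + 4 * ρ : ℤ)) ^ x) *
        ((qInf q q)⁻¹ * (qInf q q)⁻¹)))) ?_
  · simp only [hb, if_true] at key
    convert key using 1
    have := qInf_self_ne_zero hq
    field_simp
  · rcases Nat.lt_or_ge j (p + 1) with hj' | hj'
    · simp only [hb, weightB, if_neg (show j + 1 ≠ p + 2 by omega),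
        if_neg (show j ≠ p + 2 by omega), if_neg (show j ≠ p + 1 by omega), one_mul]
      rw [← sum_coreWeight ht ht0 h hlo (by omega), mul_sum]
      refine sum_congr rfl fun k _ => ?_
      split_ifs
      -- The denominator (-q^{1+m/2})_{s_{r-1}} of the summand cancels the factor left by the half
      -- step on s_r.
      · have := qPoch_ne_zero ht ht0 h m k
        field_simp
      · ring
    · obtain rfl : j = p + 1 := by omega
      simp only [hb, weightB, if_true, if_neg (show p + 1 ≠ p + 2 by omega)]
      rw [sum_bailey_half ht ht0 h m hlo, show i - (p + 1) = 0 by omega, mixedKer_zero, coreFactor,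
        max_eq_right hi]
      simp [hi]
      ring
  · simp only [hb, if_neg (show 0 ≠ p + 2 by omega), if_neg (show 0 ≠ p + 1 by omega), one_mul,
      Nat.sub_zero]
    exact ((tendsto_mixedKer ht h m i ρ lo).const_mul _).const_mul _

/-- Here the half weight sits on s_1, so the half step comes last. For i = 0 it still meets the
plain kernel. -/
theorem hasSum_weightC_zero (ht : ‖t‖ < 1) (ht0 : t ≠ 0) (h : t ^ 2 = q) {m p : ℕ} {lo : ℤ}
    (hlo : 2 * lo ≤ 1 - m) (ρ : ℤ) :
    HasSum (fun s : DecSeq (p + 1) lo =>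
        chainTerm q (weightC t q m 0) s * baileyKer q m ρ (s.entry (p + 1)))
      ((qInf q q)⁻¹ * (coreFactor t m 0 (p + 1) 1 ρ * halfEig t m ρ *
        qInf (-(q * t ^ m)) q)) := by
  have hq := norm_sq_lt_one ht h
  have hq0 := sq_ne_zero_of_eq ht0 h
  obtain ⟨K, hK⟩ := exists_baileyKer_bound ht ht0 h m
  set b : ℕ → ℤ → ℂ := fun j N => if j = 0 then coreFactor t m 0 (p + 1) 1 ρ *
      (halfEig t m ρ * qPoch (-(q * t ^ m)) q N * baileyKer q m ρ N)
    else coreFactor t m 0 (p + 1) j ρ * mixedKer t q m (0 - j) ρ N with hb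
  have key := hasSum_chainTerm hq hq0 p (w := weightC t q m 0) (lo := lo)
    (fun j _ _ => summable_weightC ht ht0 h m 0 j lo) (b := b) (K := K)
    (fun k _ => by simpa [hb, coreFactor, mixedKer_zero] using hK ρ k) (fun j hj N hN => ?_)
    (G := coreFactor t m 0 (p + 1) 1 ρ * (halfEig t m ρ * qInf (-(q * t ^ m)) q *
      ((qInf q q)⁻¹ * (qInf q q)⁻¹))) ?_
  · simp only [hb, if_neg (show p + 1 ≠ 0 by omega)] at key
    convert key using 1
    · funext s
      simp [coreFactor, mixedKer_zero]
    · have := qInf_self_ne_zero hq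
      field_simp
  · rcases Nat.eq_zero_or_pos j with rfl | hj'
    · simp only [hb, weightC, if_true, zero_add, one_ne_zero, if_false,
        show ¬ (1 ≤ 0) by omega, sub_zero]
      rw [← sum_bailey_half ht ht0 h m hlo, mul_sum]
      refine sum_congr rfl fun k _ => ?_
      simp only [Nat.sub_eq_zero_of_le (Nat.zero_le 1), mixedKer_zero]
      ring
    · simp only [hb, weightC, if_neg (show j + 1 ≠ 1 by omega), if_neg (show j + 1 ≠ 0 by omega),
        if_neg (show j ≠ 0 by omega)]
      exact sum_coreWeight ht ht0 h hlo (by omega) ρ N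
  · simp only [hb, if_true]
    exact (((tendsto_qPoch hq hq0 _ lo fun k _ =>
      neg_mul_pow_mul_zpow_ne_one ht ht0 h m k).const_mul _).mul
        (tendsto_baileyKer ht h m ρ lo)).const_mul _

/-- With a linear term on s_1 the last step acts on a mixed kernel, whence two summands, only one of
which has the denominator of `halfEig`. -/
theorem hasSum_weightC_succ (ht : ‖t‖ < 1) (ht0 : t ≠ 0) (h : t ^ 2 = q) {m p i : ℕ} {lo : ℤ}
    (hlo : 2 * lo ≤ 1 - m) (hi : i ≤ p) (ρ : ℤ) :
    HasSum (fun s : DecSeq (p + 1) lo =>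
        chainTerm q (weightC t q m (i + 1)) s * baileyKer q m ρ (s.entry (p + 1)))
      ((qInf q q)⁻¹ * (coreFactor t m (i + 1) (p + 1) 1 ρ *
        (t ^ (-(2 * ρ)) * (halfEig t m ρ * qInf (-(q * t ^ m)) q)
          + (∑ x ∈ range (i + 1), (t ^ (2 * m + 4 * ρ : ℤ)) ^ x) *
            (t ^ ((ρ + 1) ^ 2 + (m - 1) * (ρ + 1)) * qInf (-t ^ m) q)))) := by
  have hq := norm_sq_lt_one ht h
  have hq0 := sq_ne_zero_of_eq ht0 h
  obtain ⟨K, hK⟩ := exists_baileyKer_bound ht ht0 h m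
  set b : ℕ → ℤ → ℂ := fun j N => if j = 0 then coreFactor t m (i + 1) (p + 1) 1 ρ *
      (t ^ (-(2 * ρ)) * (halfEig t m ρ * qPoch (-(q * t ^ m)) q N * baileyKer q m ρ N)
        + (∑ x ∈ range (i + 1), (t ^ (2 * m + 4 * ρ : ℤ)) ^ x) *
          (t ^ ((ρ + 1) ^ 2 + (m - 1) * (ρ + 1)) * qPoch (-t ^ m) q N *
            baileyKer q (m - 1) (ρ + 1) N))
    else coreFactor t m (i + 1) (p + 1) j ρ * mixedKer t q m (i + 1 - j) ρ N with hb
  have hlast : ∀ N, b (p + 1) N = baileyKer q m ρ N := fun N => by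
    simp [hb, coreFactor, show i + 1 - (p + 1) = 0 by omega, mixedKer_zero, hi]
  have key := hasSum_chainTerm hq hq0 p (w := weightC t q m (i + 1)) (lo := lo)
    (fun j _ _ => summable_weightC ht ht0 h m (i + 1) j lo) (b := b) (K := K)
    (fun k _ => by rw [hlast]; exact hK ρ k) (fun j hj N hN => ?_)
    (G := coreFactor t m (i + 1) (p + 1) 1 ρ *
      (t ^ (-(2 * ρ)) * (halfEig t m ρ * qInf (-(q * t ^ m)) q * ((qInf q q)⁻¹ * (qInf q q)⁻¹))
        + (∑ x ∈ range (i + 1), (t ^ (2 * m + 4 * ρ : ℤ)) ^ x) *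
          (t ^ ((ρ + 1) ^ 2 + (m - 1) * (ρ + 1)) * qInf (-t ^ m) q *
            ((qInf q q)⁻¹ * (qInf q q)⁻¹)))) ?_
  · simp only [hlast] at key
    convert key using 1
    have := qInf_self_ne_zero hq
    field_simp
  · rcases Nat.eq_zero_or_pos j with rfl | hj'
    · simp only [hb, weightC, if_true, zero_add, one_ne_zero, if_false,
        show 1 ≤ i + 1 by omega, Nat.add_sub_cancel]
      rw [← sum_mixedKer_half ht ht0 h m hlo, mul_sum]
      refine sum_congr rfl fun k _ => ?_
      rw [show k ^ 2 + k + (m : ℤ) * k - 2 * k = k ^ 2 + (m - 1) * k by ring]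
      ring
    · simp only [hb, weightC, if_neg (show j + 1 ≠ 1 by omega), if_neg (show j + 1 ≠ 0 by omega),
        if_neg (show j ≠ 0 by omega)]
      exact sum_coreWeight ht ht0 h hlo (by omega) ρ N
  · simp only [hb, if_true]
    refine Tendsto.const_mul _ (Tendsto.add (Tendsto.const_mul _ ?_) (Tendsto.const_mul _ ?_))
    · exact ((tendsto_qPoch hq hq0 _ lo fun k _ =>
        neg_mul_pow_mul_zpow_ne_one ht ht0 h m k).const_mul _).mul (tendsto_baileyKer ht h m ρ lo)
    · exact ((tendsto_qPoch hq hq0 _ lo fun k _ =>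
        neg_pow_mul_zpow_ne_one ht ht0 h m k).const_mul _).mul
          (tendsto_baileyKer ht h (m - 1) (ρ + 1) lo)

end Multisums

/-! ### Symmetrization of the bilateral series and theta evaluation -/

section Theta

variable {t : ℂ}

/-- The exponent of `t` in the bilateral sums. -/
def thetaExp (R m i : ℕ) (ρ : ℤ) : ℤ := 2 * R * ρ ^ 2 + (2 * R - 1) * m * ρ - 2 * i * ρ

/-- The summand of the bilateral theta series, with a power of `y = t^(2ρ+m)`. -/
noncomputable def thetaTerm (t : ℂ) (R m i j : ℕ) (ρ : ℤ) : ℂ :=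
  (-1) ^ ρ * t ^ thetaExp R m i ρ * (t ^ (2 * ρ + m)) ^ j

theorem hasSum_thetaTerm (ht : ‖t‖ < 1) (ht0 : t ≠ 0) {R : ℕ} (hR : 1 ≤ R) (m i j : ℕ) :
    HasSum (thetaTerm t R m i j)
      (t ^ (m * j) * qInf3 (t ^ (4 * R)) (t ^ (2 * R + ((2 * R - 1) * m - 2 * i + 2 * j) : ℤ))
        (t ^ (2 * R - ((2 * R - 1) * m - 2 * i + 2 * j) : ℤ)) (t ^ (4 * R))) := by
  have h1 := (hasSum_theta ht ht0 (A := 2 * R) (by omega)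
    ((2 * R - 1) * m - 2 * i + 2 * j)).mul_left (t ^ (m * j))
  rw [show 2 * (2 * R) = 4 * R by ring] at h1
  push_cast at h1
  refine h1.congr_fun fun ρ => ?_
  rw [thetaTerm, thetaExp, ← zpow_natCast (t ^ (2 * ρ + _)), ← zpow_mul, mul_assoc,
    ← zpow_add₀ ht0, ← zpow_natCast t (m * j), mul_left_comm, ← zpow_add₀ ht0]
  congr 2
  push_cast; ring

/-- For m = 2M+1 the recentring ρ = n - M removes the product Rm from the linear exponent; the
constants it leaves form the prefactor and t^j. -/
theorem hasSum_thetaTerm_odd (ht : ‖t‖ < 1) (ht0 : t ≠ 0) {R : ℕ} (hR : 1 ≤ R) (M i j : ℕ) :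
    HasSum (thetaTerm t R (2 * M + 1) i j)
      ((-1) ^ M * t ^ (2 * (1 - R) * M ^ 2 + (1 + 2 * i - 2 * R) * M : ℤ) * (t ^ j *
        qInf3 (t ^ (4 * R)) (t ^ (2 * (2 * R - i - M + j) - 1 : ℤ))
          (t ^ (2 * (i + M - j) + 1 : ℤ)) (t ^ (4 * R)))) := by
  have h1 := (hasSum_theta ht ht0 (A := 2 * R) (by omega)
    (2 * R - 1 - 2 * M - 2 * i + 2 * j)).mul_left
      ((-1) ^ M * t ^ (2 * (1 - R) * M ^ 2 + (1 + 2 * i - 2 * R) * M : ℤ) * t ^ j)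
  rw [show 2 * (2 * R) = 4 * R by ring] at h1
  push_cast at h1
  rw [show 2 * (R : ℤ) + (2 * R - 1 - 2 * M - 2 * i + 2 * j) = 2 * (2 * R - i - M + j) - 1 by ring,
    show 2 * (R : ℤ) - (2 * R - 1 - 2 * M - 2 * i + 2 * j) = 2 * (i + M - j) + 1 by ring,
    mul_assoc _ (t ^ j)] at h1
  rw [← (Equiv.subRight (M : ℤ)).hasSum_iff]
  refine h1.congr_fun fun n => ?_
  simp only [Function.comp, Equiv.subRight_apply, thetaTerm, thetaExp]
  have e1 : (-1 : ℂ) ^ (n - M) = (-1) ^ M * (-1) ^ n := by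
    rw [zpow_sub₀ (by norm_num), zpow_natCast, div_eq_mul_inv, ← inv_pow]
    norm_num [mul_comm]
  rw [e1, ← zpow_natCast (t ^ _) j, ← zpow_mul, mul_assoc _ (t ^ _) (t ^ _), ← zpow_add₀ ht0,
    ← zpow_natCast t j, mul_assoc ((-1) ^ M) (t ^ _) (t ^ _), ← zpow_add₀ ht0,
    show ∀ a b c d : ℂ, a * b * (c * d) = a * c * (b * d) by intros; ring, ← zpow_add₀ ht0]
  congr 2
  push_cast; ring

theorem thetaExp_reflect (R m i : ℕ) (ρ : ℤ) :
    thetaExp R m i (-m - ρ) = thetaExp R m i ρ + (2 * ρ + m) * (m + 2 * i) := by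
  unfold thetaExp; ring

theorem neg_one_zpow_reflect (m : ℕ) (ρ : ℤ) : (-1 : ℂ) ^ (-m - ρ : ℤ) = (-1) ^ m * (-1) ^ ρ := by
  rw [zpow_sub₀ (by norm_num), zpow_neg, zpow_natCast, div_eq_mul_inv, ← inv_pow, ← inv_zpow]
  norm_num

/-- The summand before symmetrization. -/
noncomputable def halfTerm (t : ℂ) (R m i : ℕ) (S : ℂ → ℂ) (ρ : ℤ) : ℂ :=
  (-1) ^ ρ * t ^ thetaExp R m i ρ * S (t ^ (2 * ρ + m)) / (1 + t ^ (2 * ρ + m))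

/-- Reflection sends y = t^{2ρ+m} to 1/y. By the palindromy of S the two terms combine to S(y) (1 +
(-1)^m y^{m+1})/(1+y), and the quotient is a geometric sum. -/
theorem halfTerm_add_reflect (ht : ‖t‖ < 1) (ht0 : t ≠ 0) (R m i : ℕ) {S : ℂ → ℂ}
    (hS : ∀ y, y ≠ 0 → y ^ (2 * i) * S y⁻¹ = S y) (ρ : ℤ) :
    halfTerm t R m i S ρ + halfTerm t R m i S (-m - ρ)
      = (-1) ^ ρ * t ^ thetaExp R m i ρ * S (t ^ (2 * ρ + m)) *
        ∑ l ∈ range (m + 1), (-t ^ (2 * ρ + m)) ^ l := by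
  have h1 := one_add_zpow_ne_zero ht (2 * ρ + m)
  have h0 : t ^ (2 * ρ + m) ≠ 0 := zpow_ne_zero _ ht0
  unfold halfTerm
  rw [thetaExp_reflect, neg_one_zpow_reflect,
    show 2 * (-(m : ℤ) - ρ) + m = -(2 * ρ + m) by ring, zpow_neg, zpow_add₀ ht0 (thetaExp _ _ _ _),
    zpow_mul, show (m : ℤ) + 2 * i = ((m + 2 * i : ℕ) : ℤ) by push_cast; ring, zpow_natCast]
  generalize t ^ (2 * ρ + m) = y at h0 h1 ⊢
  have hg := geom_sum_mul (-y) (m + 1)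
  have h2 : ∑ l ∈ range (m + 1), (-y) ^ l = (1 + (-1) ^ m * y ^ (m + 1)) / (1 + y) := by
    rw [eq_div_iff h1]
    rw [neg_pow y (m + 1), pow_succ] at hg
    linear_combination -hg
  have h3 : 1 + y⁻¹ = (1 + y) / y := by field_simp; ring
  rw [h2, h3, ← hS y h0]
  generalize S y⁻¹ = s
  field_simp
  ring

theorem hasSum_reflect {f : ℤ → ℂ} {V : ℂ} (h : HasSum f V) (m : ℕ) :
    HasSum (fun ρ => f ρ + f (-m - ρ)) (2 * V) := by
  rw [two_mul]
  exact h.add ((Equiv.subLeft (-m : ℤ)).hasSum_iff.2 h)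

theorem sum_pow_palindromic {a n i : ℕ} (han : a * n = 2 * i) {y : ℂ} (hy : y ≠ 0) :
    y ^ (2 * i) * ∑ k ∈ range (n + 1), y⁻¹ ^ (a * k) = ∑ k ∈ range (n + 1), y ^ (a * k) := by
  rw [← sum_range_reflect, mul_sum]
  refine sum_congr rfl fun k hk => ?_
  rw [mem_range] at hk
  have : a * (n + 1 - 1 - k) + a * k = 2 * i := by
    rw [← mul_add, ← han]; congr 1; omega
  rw [← this, pow_add, inv_pow]
  field_simp

/-- The pair (a, n) is (2, i) for the first identity and (1, 2i) for the second. The factor 1/2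
comes from counting every ρ twice in the symmetrization. -/
theorem halfTerm_value (ht : ‖t‖ < 1) (ht0 : t ≠ 0) {R : ℕ} (hR : 1 ≤ R) {m i a n : ℕ}
    (han : a * n = 2 * i) {C V : ℂ}
    (hV : HasSum (fun ρ => C * halfTerm t R m i (fun y => ∑ k ∈ range (n + 1), y ^ (a * k)) ρ) V) :
    V = C / 2 * ∑ k ∈ range (n + 1), ∑ l ∈ range (m + 1), (-1) ^ l * (t ^ (m * (a * k + l)) *
      qInf3 (t ^ (4 * R))
        (t ^ (2 * R + ((2 * R - 1) * m - 2 * i + 2 * (a * k + l : ℕ)) : ℤ))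
        (t ^ (2 * R - ((2 * R - 1) * m - 2 * i + 2 * (a * k + l : ℕ)) : ℤ)) (t ^ (4 * R))) := by
  have h1 := hasSum_reflect hV m
  have h2 := (hasSum_sum fun k (_ : k ∈ range (n + 1)) => hasSum_sum
    fun l (_ : l ∈ range (m + 1)) =>
      (hasSum_thetaTerm ht ht0 hR m i (a * k + l)).mul_left ((-1) ^ l)).mul_left C
  have h3 := h1.unique (h2.congr_fun fun ρ => by
    rw [← mul_add, halfTerm_add_reflect ht ht0 R m i fun y hy => sum_pow_palindromic han hy,
      mul_assoc _ (∑ k ∈ _, _), sum_mul_sum, mul_sum]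
    congr 1
    refine sum_congr rfl fun k _ => ?_
    rw [mul_sum]
    refine sum_congr rfl fun l _ => ?_
    rw [thetaTerm, neg_pow, pow_add]
    ring)
  linear_combination (1 / 2) * h3

theorem sum_neg_pow_odd (y : ℂ) (M : ℕ) :
    ∑ l ∈ range (2 * M + 1 + 1), (-y) ^ l = (1 - y) * ∑ l ∈ range (M + 1), y ^ (2 * l) := by
  induction M with
  | zero => simp [sum_range_succ]; ring
  | succ M ih =>
    have e : (-y) ^ (2 * M + 1 + 1) = y ^ (2 * (M + 1)) := (even_two_mul (M + 1)).neg_pow y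
    rw [show 2 * (M + 1) + 1 + 1 = 2 * M + 1 + 1 + 1 + 1 by ring, sum_range_succ, sum_range_succ, ih,
      sum_range_succ _ (M + 1), pow_succ (-y) (2 * M + 1 + 1), e]
    ring

theorem halfTerm_value_odd (ht : ‖t‖ < 1) (ht0 : t ≠ 0) {R : ℕ} (hR : 1 ≤ R) {M i : ℕ}
    {C V : ℂ} (hV : HasSum (fun ρ => C * halfTerm t R (2 * M + 1) i
      (fun y => ∑ k ∈ range (i + 1), y ^ (2 * k)) ρ) V) :
    V = C / 2 * ∑ k ∈ range (i + 1), ∑ l ∈ range (M + 1),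
      ((-1) ^ M * t ^ (2 * (1 - R) * M ^ 2 + (1 + 2 * i - 2 * R) * M : ℤ) * (t ^ (2 * k + 2 * l) *
        qInf3 (t ^ (4 * R)) (t ^ (2 * (2 * R - i - M + (2 * k + 2 * l : ℕ)) - 1 : ℤ))
          (t ^ (2 * (i + M - (2 * k + 2 * l : ℕ)) + 1 : ℤ)) (t ^ (4 * R)))
      - (-1) ^ M * t ^ (2 * (1 - R) * M ^ 2 + (1 + 2 * i - 2 * R) * M : ℤ) *
        (t ^ (2 * k + 2 * l + 1) *
        qInf3 (t ^ (4 * R)) (t ^ (2 * (2 * R - i - M + (2 * k + 2 * l + 1 : ℕ)) - 1 : ℤ))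
          (t ^ (2 * (i + M - (2 * k + 2 * l + 1 : ℕ)) + 1 : ℤ)) (t ^ (4 * R)))) := by
  have h1 := hasSum_reflect hV (2 * M + 1)
  have h2 := (hasSum_sum fun k (_ : k ∈ range (i + 1)) => hasSum_sum
    fun l (_ : l ∈ range (M + 1)) =>
      (hasSum_thetaTerm_odd ht ht0 hR M i (2 * k + 2 * l)).sub
        (hasSum_thetaTerm_odd ht ht0 hR M i (2 * k + 2 * l + 1))).mul_left C
  have h3 := h1.unique (h2.congr_fun fun ρ => by
    rw [← mul_add, halfTerm_add_reflect ht ht0 R _ i fun y hy => sum_pow_palindromic rfl hy,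
      sum_neg_pow_odd, mul_left_comm _ (1 - _), mul_assoc _ (∑ k ∈ _, _), sum_mul_sum, mul_sum,
      mul_sum]
    congr 1
    refine sum_congr rfl fun k _ => ?_
    rw [mul_sum, mul_sum]
    refine sum_congr rfl fun l _ => ?_
    rw [thetaTerm, thetaTerm, pow_succ, pow_add]
    ring)
  linear_combination (1 / 2) * h3

/-- Reflection turns ∑ y^{2l} into -y^{2i+1} ∑ y^{2l}, the sign being (-1)^m. This supplies the
second term of (1-y) ∑_{k≤2i} y^k = 1 - y^{2i+1}. -/
theorem thetaTerm_reflect_odd (ht0 : t ≠ 0) (R M i : ℕ) (ρ : ℤ) :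
    ∑ l ∈ range (M + 1), thetaTerm t R (2 * M + 1) i (2 * l) (-(2 * M + 1 : ℕ) - ρ)
      = -((-1) ^ ρ * t ^ thetaExp R (2 * M + 1) i ρ *
        (t ^ (2 * ρ + (2 * M + 1 : ℕ))) ^ (2 * i + 1) *
          ∑ l ∈ range (M + 1), (t ^ (2 * ρ + (2 * M + 1 : ℕ))) ^ (2 * l)) := by
  have h0 : t ^ (2 * ρ + (2 * M + 1 : ℕ)) ≠ 0 := zpow_ne_zero _ ht0
  rw [← sum_range_reflect, mul_sum, ← sum_neg_distrib]
  refine sum_congr rfl fun l hl => ?_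
  rw [mem_range] at hl
  rw [thetaTerm, thetaExp_reflect, neg_one_zpow_reflect, zpow_add₀ ht0 (thetaExp _ _ _ _), zpow_mul,
    show 2 * (-((2 * M + 1 : ℕ) : ℤ) - ρ) + (2 * M + 1 : ℕ) = -(2 * ρ + (2 * M + 1 : ℕ)) by ring,
    zpow_neg, show ((2 * M + 1 : ℕ) : ℤ) + 2 * i = ((2 * M + 1 + 2 * i : ℕ) : ℤ) by push_cast; ring,
    zpow_natCast]
  generalize t ^ (2 * ρ + ((2 * M + 1 : ℕ) : ℤ)) = y at h0 ⊢
  have e : y ^ (2 * M + 1 + 2 * i) * y⁻¹ ^ (2 * (M + 1 - 1 - l)) = y ^ (2 * i + 1) * y ^ (2 * l) := by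
    rw [inv_pow, ← div_eq_mul_inv, div_eq_iff (pow_ne_zero _ h0), ← pow_add, ← pow_add]
    congr 1; omega
  rw [(odd_two_mul_add_one M).neg_one_pow]
  linear_combination (-(-1) ^ ρ * t ^ thetaExp R (2 * M + 1) i ρ) * e

/-- The half-term series and the theta series summed over l have the same symmetrization, hence the
same sum: the sum over k telescopes and no factor 1/2 remains. -/
theorem halfTerm_value_odd' (ht : ‖t‖ < 1) (ht0 : t ≠ 0) {R : ℕ} (hR : 1 ≤ R) {M i : ℕ}
    {C V : ℂ} (hV : HasSum (fun ρ => C * halfTerm t R (2 * M + 1) i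
      (fun y => ∑ k ∈ range (2 * i + 1), y ^ (1 * k)) ρ) V) :
    V = C * ∑ l ∈ range (M + 1),
      ((-1) ^ M * t ^ (2 * (1 - R) * M ^ 2 + (1 + 2 * i - 2 * R) * M : ℤ) * (t ^ (2 * l) *
        qInf3 (t ^ (4 * R)) (t ^ (2 * (2 * R - i - M + (2 * l : ℕ)) - 1 : ℤ))
          (t ^ (2 * (i + M - (2 * l : ℕ)) + 1 : ℤ)) (t ^ (4 * R)))) := by
  have h1 := hasSum_reflect hV (2 * M + 1)
  have h2 := hasSum_reflect ((hasSum_sum fun l (_ : l ∈ range (M + 1)) =>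
      hasSum_thetaTerm_odd ht ht0 hR M i (2 * l)).mul_left C) (2 * M + 1)
  have h3 := h1.unique (h2.congr_fun fun ρ => by
    rw [← mul_add, halfTerm_add_reflect ht ht0 R _ i fun y hy =>
      sum_pow_palindromic (one_mul _) hy, ← mul_add, thetaTerm_reflect_odd ht0, sum_neg_pow_odd]
    congr 1
    simp only [thetaTerm, one_mul, ← mul_sum]
    have hg := mul_neg_geom_sum (t ^ (2 * ρ + ((2 * M + 1 : ℕ) : ℤ))) (2 * i + 1)
    linear_combination ((-1) ^ ρ * t ^ thetaExp R (2 * M + 1) i ρ *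
      ∑ l ∈ range (M + 1), (t ^ (2 * ρ + ((2 * M + 1 : ℕ) : ℤ))) ^ (2 * l)) * hg)
  linear_combination (1 / 2) * h3

end Theta

/-! ### Matching the summands with chains and the bilateral series -/

section Assembly

variable {t q : ℂ}

theorem prod_zpow_eq_zpow_sum (ht0 : t ≠ 0) {ι : Type*} (S : Finset ι) (f : ι → ℤ) :
    ∏ j ∈ S, t ^ f j = t ^ ∑ j ∈ S, f j := by
  classical
  induction S using Finset.induction_on with
  | empty => simp
  | insert a S ha ih => rw [prod_insert ha, sum_insert ha, ih, zpow_add₀ ht0]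

theorem prod_coreWeight (ht0 : t ≠ 0) (h : t ^ 2 = q) (m i : ℕ) (S : Finset ℕ) (f : ℕ → ℤ) :
    ∏ j ∈ S, coreWeight t m i j (f j)
      = q ^ ((∑ j ∈ S, f j ^ 2) + m * (∑ j ∈ S, f j) - ∑ j ∈ S.filter (· ≤ i), f j) := by
  unfold coreWeight
  rw [prod_zpow_eq_zpow_sum ht0, zpow_eq_zpow_two_mul h]
  congr 1
  rw [sum_sub_distrib, sum_add_distrib, ← sum_filter, ← mul_sum, ← mul_sum, ← mul_sum]
  ring

theorem prod_rq_eq (q : ℂ) (S : Finset ℕ) (f : ℕ → ℤ) :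
    ∏ j ∈ S, rq q (f j) = (∏ j ∈ S, qPoch q q (f j))⁻¹ := by
  simp only [rq, prod_inv_distrib]

/-- The inner factor shared by both multi-sums. -/
noncomputable def seedBeta (t q : ℂ) (m : ℕ) (k : ℤ) : ℂ :=
  (-1) ^ k * t ^ (k ^ 2 - k) * qBinom q (m + k) (m + 2 * k)

theorem termB_eq (ht0 : t ≠ 0) (h : t ^ 2 = q) {m p i : ℕ} (hi : i ≤ p + 1)
    (s : DecSeq (p + 2) (-((m / 2 : ℕ) : ℤ))) :
    termB q t m (p + 2) i s = chainTerm q (weightB t q m p i) s * seedBeta t q m (s.entry (p + 2)) := by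
  have hf : (Icc 1 (p + 1)).filter (· ≤ i) = Icc 1 i := by
    ext j; simp only [mem_filter, mem_Icc]; omega
  have h1 : ∏ j ∈ Icc 1 (p + 1), weightB t q m p i j (s.entry j)
      = (qPoch (-(q * t ^ m)) q (s.entry (p + 1)))⁻¹ *
        ∏ j ∈ Icc 1 (p + 1), coreWeight t m i j (s.entry j) := by
    rw [prod_Icc_succ_top (by omega), prod_Icc_succ_top (by omega), mul_left_comm]
    congr 1
    · refine prod_congr rfl fun j hj => ?_
      rw [mem_Icc] at hj
      rw [weightB, if_neg (by omega), if_neg (by omega), one_mul]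
    · rw [weightB, if_neg (by omega), if_pos rfl]
  have h2 : weightB t q m p i (p + 2) (s.entry (p + 2)) = qPoch (-t ^ m) q (s.entry (p + 2)) *
      t ^ (s.entry (p + 2) ^ 2 + s.entry (p + 2) + m * s.entry (p + 2)) := if_pos rfl
  rw [termB, chainTerm, seedBeta, prod_Icc_succ_top (b := p + 1) (by omega), h1, h2,
    prod_coreWeight ht0 h, hf, prod_rq_eq, show p + 2 - 1 = p + 1 from rfl,
    sum_Icc_succ_top (b := p + 1) (by omega)]
  generalize s.entry (p + 2) = k
  have e1 : q ^ (∑ j ∈ Icc 1 (p + 1), s.entry j ^ 2 + k ^ 2 + m * ∑ j ∈ Icc 1 (p + 1), s.entry j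
      - ∑ j ∈ Icc 1 i, s.entry j)
      = q ^ (∑ j ∈ Icc 1 (p + 1), s.entry j ^ 2 + m * ∑ j ∈ Icc 1 (p + 1), s.entry j
      - ∑ j ∈ Icc 1 i, s.entry j) * q ^ (k ^ 2) := by
    rw [← zpow_add₀ (sq_ne_zero_of_eq ht0 h)]; congr 1; ring
  -- In the first identity q^{s_r²} is shared: q^{(k²+k)/2} goes to the half weight and q^{(k²-k)/2}
  -- to the seed.
  have e2 : q ^ (k ^ 2) * t ^ (m * k) = t ^ (k ^ 2 + k + m * k) * t ^ (k ^ 2 - k) := by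
    rw [zpow_eq_zpow_two_mul h, ← zpow_add₀ ht0, ← zpow_add₀ ht0]; congr 1; ring
  rw [e1, mul_assoc (q ^ _) (q ^ _), e2, div_eq_mul_inv, mul_inv]
  ring

theorem termC_eq (ht0 : t ≠ 0) (h : t ^ 2 = q) {m p i : ℕ} (hi : i ≤ p + 1)
    (s : DecSeq (p + 2) (-((m / 2 : ℕ) : ℤ))) :
    termC q t m (p + 2) i s = chainTerm q (weightC t q m i) s * seedBeta t q m (s.entry (p + 2)) := by
  have hI : Icc 1 (p + 2) = insert 1 (Icc 2 (p + 2)) := by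
    ext j; simp only [mem_insert, mem_Icc]; omega
  have h1 : ∏ j ∈ Icc 2 (p + 2), weightC t q m i j (s.entry j)
      = ∏ j ∈ Icc 2 (p + 2), coreWeight t m i j (s.entry j) :=
    prod_congr rfl fun j hj => by
      rw [mem_Icc] at hj
      rw [weightC, if_neg (by omega)]
  have h2 : weightC t q m i 1 (s.entry 1) = qPoch (-t ^ m) q (s.entry 1) *
      t ^ (s.entry 1 ^ 2 + s.entry 1 + m * s.entry 1 - if 1 ≤ i then 2 * s.entry 1 else 0) :=
    if_pos rfl
  have h3 : ∑ j ∈ Icc 1 i, s.entry j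
      = (if 1 ≤ i then s.entry 1 else 0) + ∑ j ∈ (Icc 2 (p + 2)).filter (· ≤ i), s.entry j := by
    have : (Icc 2 (p + 2)).filter (· ≤ i) = Icc 2 i := by
      ext j; simp only [mem_filter, mem_Icc]; omega
    rw [this]
    split_ifs with hc
    · have : Icc 1 i = insert 1 (Icc 2 i) := by
        ext j; simp only [mem_insert, mem_Icc]; omega
      rw [this, sum_insert (by simp)]
    · obtain rfl : i = 0 := by omega
      simp
  rw [termC, chainTerm, seedBeta, hI, prod_insert (by simp), h1, h2, prod_coreWeight ht0 h, h3,
    prod_rq_eq, show p + 2 - 1 = p + 1 from rfl]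
  generalize s.entry (p + 2) = k
  generalize s.entry 1 = k1
  generalize ∑ j ∈ Icc 2 (p + 2), s.entry j ^ 2 = a
  generalize ∑ j ∈ Icc 2 (p + 2), s.entry j = b
  generalize ∑ j ∈ (Icc 2 (p + 2)).filter (· ≤ i), s.entry j = c
  have e1 : q ^ (k * (k - 1) / 2) = t ^ (k ^ 2 - k) := by
    rw [zpow_eq_zpow_two_mul h, Int.mul_ediv_cancel' (Int.even_mul_pred_self k).two_dvd]
    congr 1; ring
  have e2 : t ^ (k1 ^ 2 + m * k1 + k1) * q ^ (a + m * b - ((if 1 ≤ i then k1 else 0) + c))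
      = t ^ (k1 ^ 2 + k1 + m * k1 - if 1 ≤ i then 2 * k1 else 0) * q ^ (a + m * b - c) := by
    rw [zpow_eq_zpow_two_mul h, zpow_eq_zpow_two_mul h, ← zpow_add₀ ht0, ← zpow_add₀ ht0]
    congr 1
    split_ifs <;> ring
  rw [e1, e2, div_eq_mul_inv]
  ring

theorem exists_hasSum_seed (ht : ‖t‖ < 1) (ht0 : t ≠ 0) (h : t ^ 2 = q) {m n : ℕ}
    {w : ℕ → ℤ → ℂ} {lo : ℤ} (hlo : 0 ≤ m + 2 * lo)
    (hw : ∀ j, Summable fun k : {k : ℤ // lo ≤ k} => ‖w j k‖) {X : ℤ → ℂ}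
    (hX : ∀ ρ, HasSum (fun s : DecSeq (n + 1) lo =>
      chainTerm q w s * baileyKer q m ρ (s.entry (n + 1))) (X ρ)) :
    ∃ V, HasSum (fun ρ : ℤ => (-1) ^ ρ * t ^ (ρ ^ 2 - ρ) * X ρ) V ∧
      HasSum (fun s : DecSeq (n + 1) lo => chainTerm q w s * seedBeta t q m (s.entry (n + 1))) V := by
  obtain ⟨K, hK⟩ := exists_baileyKer_bound ht ht0 h m
  refine hasSum_chainTerm_of_expansion (norm_sq_lt_one ht h) (sq_ne_zero_of_eq ht0 h) n
    (fun j _ _ => hw j) (c := fun ρ => (-1) ^ ρ * t ^ (ρ ^ 2 - ρ)) ?_ hK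
    (fun k hk => hasSum_seed ht h ht0 m (by omega)) hX
  refine (summable_norm_zpow_quadratic ht ht0 (A := 1) le_rfl (-1)).congr fun ρ => ?_
  rw [norm_mul, norm_zpow (-1), norm_neg, norm_one, one_zpow, one_mul]
  ring_nf

theorem exists_hasSum_termB (ht : ‖t‖ < 1) (ht0 : t ≠ 0) (h : t ^ 2 = q) (m : ℕ) {p i : ℕ}
    (hi : i ≤ p + 1) :
    ∃ V, HasSum (fun ρ => (1 + t ^ m) / qInf q q *
        halfTerm t (p + 2) m i (fun y => ∑ k ∈ range (i + 1), y ^ (2 * k)) ρ) V ∧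
      HasSum (fun s => termB q t m (p + 2) i s) V := by
  simp only [termB_eq ht0 h hi]
  obtain ⟨V, h1, h2⟩ := exists_hasSum_seed (n := p + 1) ht ht0 h
    (lo := -((m / 2 : ℕ) : ℤ)) (m := m) (by omega)
    (fun j => summable_weightB ht ht0 h m p i j _)
    (fun ρ => hasSum_weightB ht ht0 h (by omega) hi ρ)
  refine ⟨V, h1.congr_fun fun ρ => ?_, h2⟩
  have e1 : ∀ k : ℕ, (t ^ (2 * m + 4 * ρ : ℤ)) ^ k = (t ^ (2 * ρ + m)) ^ (2 * k) := fun k => by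
    rw [pow_mul, ← zpow_natCast (t ^ (2 * ρ + m)) 2, ← zpow_mul]; congr 2; push_cast; ring
  simp only [e1]
  rw [halfTerm, halfEig, coreFactor, max_eq_left (Nat.zero_le _), Nat.sub_zero, ← zpow_natCast (t ^ _),
    ← zpow_natCast (t ^ _), ← zpow_mul, ← zpow_mul, Nat.cast_sub hi]
  have e2 : t ^ thetaExp (p + 2) m i ρ = t ^ (ρ ^ 2 - ρ) * t ^ (ρ ^ 2 + ρ + m * ρ) *
      t ^ ((2 * ρ ^ 2 + 2 * m * ρ) * ((p + 1 : ℕ) - i)) *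
      t ^ ((2 * ρ ^ 2 + 2 * (m - 1) * ρ) * i) := by
    rw [← zpow_add₀ ht0, ← zpow_add₀ ht0, ← zpow_add₀ ht0, thetaExp]; congr 1; push_cast; ring
  rw [e2, zpow_natCast, add_comm (m : ℤ) (2 * ρ)]
  have := one_add_zpow_ne_zero ht (2 * ρ + m)
  have := qInf_self_ne_zero (norm_sq_lt_one ht h)
  field_simp

/-- Puts the two summands of `hasSum_weightC_succ` over the common denominator 1+y, with numerator 1
+ y + … + y^{2(i+1)}. -/
theorem sum_pow_range_odd (y : ℂ) (i : ℕ) :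
    ∑ k ∈ range (2 * (i + 1) + 1), y ^ k = 1 + (1 + y) * (y * ∑ x ∈ range (i + 1), (y ^ 2) ^ x) := by
  induction i with
  | zero => simp [sum_range_succ]; ring
  | succ i ih =>
    rw [show 2 * (i + 1 + 1) + 1 = 2 * (i + 1) + 1 + 1 + 1 by ring, sum_range_succ, sum_range_succ, ih,
      sum_range_succ _ (i + 1)]
    ring

theorem qInf_neg_pow_eq (ht : ‖t‖ < 1) (h : t ^ 2 = q) (m : ℕ) :
    qInf (-t ^ m) q = (1 + t ^ m) * qInf (-(q * t ^ m)) q := by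
  rw [qInf_eq_mul (norm_sq_lt_one ht h), sub_neg_eq_add]; congr 2; ring

theorem exists_hasSum_termC (ht : ‖t‖ < 1) (ht0 : t ≠ 0) (h : t ^ 2 = q) (m : ℕ) {p i : ℕ}
    (hi : i ≤ p + 1) :
    ∃ V, HasSum (fun ρ => qInf (-t ^ m) q / qInf q q *
        halfTerm t (p + 2) m i (fun y => ∑ k ∈ range (2 * i + 1), y ^ (1 * k)) ρ) V ∧
      HasSum (fun s => termC q t m (p + 2) i s) V := by
  simp only [termC_eq ht0 h hi, one_mul]
  have h0 := qInf_self_ne_zero (norm_sq_lt_one ht h)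
  rcases i with _ | i
  · obtain ⟨V, h1, h2⟩ := exists_hasSum_seed (n := p + 1) ht ht0 h
      (lo := -((m / 2 : ℕ) : ℤ)) (m := m) (by omega)
      (fun j => summable_weightC ht ht0 h m 0 j _)
      (fun ρ => hasSum_weightC_zero ht ht0 h (by omega) ρ)
    refine ⟨V, h1.congr_fun fun ρ => ?_, h2⟩
    rw [halfTerm, halfEig, coreFactor, max_eq_right (Nat.zero_le _), Nat.zero_sub, pow_zero, mul_one,
      ← zpow_natCast (t ^ _), ← zpow_mul, qInf_neg_pow_eq ht h]
    have e2 : t ^ thetaExp (p + 2) m 0 ρ = t ^ (ρ ^ 2 - ρ) * t ^ (ρ ^ 2 + ρ + m * ρ) *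
        t ^ ((2 * ρ ^ 2 + 2 * m * ρ) * (p + 1 + 1 - 1 : ℕ)) := by
      rw [← zpow_add₀ ht0, ← zpow_add₀ ht0, thetaExp]; congr 1; push_cast; ring
    rw [e2, zpow_natCast, add_comm (m : ℤ) (2 * ρ)]
    have := one_add_zpow_ne_zero ht (2 * ρ + m)
    simp only [mul_zero, zero_add, sum_range_one, pow_zero]
    field_simp
  · obtain ⟨V, h1, h2⟩ := exists_hasSum_seed (n := p + 1) ht ht0 h
      (lo := -((m / 2 : ℕ) : ℤ)) (m := m) (by omega)
      (fun j => summable_weightC ht ht0 h m (i + 1) j _)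
      (fun ρ => hasSum_weightC_succ ht ht0 h (by omega) (by omega) ρ)
    refine ⟨V, h1.congr_fun fun ρ => ?_, h2⟩
    rw [halfTerm, halfEig, coreFactor, max_eq_left (by omega), Nat.add_sub_cancel,
      ← zpow_natCast (t ^ _) (_ - _), ← zpow_natCast (t ^ _) i, ← zpow_mul, ← zpow_mul,
      Nat.cast_sub (by omega), sum_pow_range_odd, qInf_neg_pow_eq ht h]
    have e1 : ∀ k : ℕ, (t ^ (2 * m + 4 * ρ : ℤ)) ^ k = ((t ^ (2 * ρ + m)) ^ 2) ^ k := fun k => by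
      rw [← zpow_natCast (t ^ (2 * ρ + m)) 2, ← zpow_mul]; congr 2; push_cast; ring
    simp only [e1]
    generalize ∑ x ∈ range (i + 1), ((t ^ (2 * ρ + m)) ^ 2) ^ x = z
    have e2 : t ^ thetaExp (p + 2) m (i + 1) ρ = t ^ (ρ ^ 2 - ρ) *
        t ^ ((2 * ρ ^ 2 + 2 * m * ρ) * ((p + 1 + 1 : ℕ) - (i + 1 : ℕ))) *
        t ^ ((2 * ρ ^ 2 + 2 * (m - 1) * ρ) * i) * (t ^ (-(2 * ρ)) * t ^ (ρ ^ 2 + ρ + m * ρ)) := by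
      rw [← zpow_add₀ ht0, ← zpow_add₀ ht0, ← zpow_add₀ ht0, ← zpow_add₀ ht0, thetaExp]
      congr 1; push_cast; ring
    have e3 : t ^ ((ρ + 1) ^ 2 + (m - 1) * (ρ + 1))
        = t ^ (-(2 * ρ)) * t ^ (ρ ^ 2 + ρ + m * ρ) * t ^ (2 * ρ + m) := by
      rw [← zpow_add₀ ht0, ← zpow_add₀ ht0]; congr 1; ring
    rw [e2, e3, zpow_natCast, add_comm (m : ℤ) (2 * ρ)]
    have := one_add_zpow_ne_zero ht (2 * ρ + m)
    field_simp

end Assembly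

/-! ### Closed forms, and the case m = 0 -/

section Values

variable {t q : ℂ}

theorem hasSum_termB_bVal (ht : ‖t‖ < 1) (ht0 : t ≠ 0) (h : t ^ 2 = q) (m : ℕ) {p i : ℕ}
    (hi : i ≤ p + 1) : HasSum (fun s => termB q t m (p + 2) i s) (bVal q t m (p + 2) i) := by
  obtain ⟨V, h1, h2⟩ := exists_hasSum_termB ht ht0 h m hi
  convert h2 using 1
  have h0 := qInf_self_ne_zero (norm_sq_lt_one ht h)
  unfold bVal
  split_ifs with hm
  · obtain ⟨M, rfl⟩ := hm.two_dvd
    rw [halfTerm_value ht ht0 (by omega) rfl h1, bEven, Nat.mul_div_cancel_left M two_pos]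
    rw [show (1 + q ^ M) / (2 * qInf q q) = (1 + t ^ (2 * M)) / qInf q q / 2 by
      rw [pow_mul, h]; field_simp]
    congr 1
    refine sum_congr rfl fun k _ => sum_congr rfl fun l _ => ?_
    rw [mul_assoc, zpow_eq_zpow_two_mul h, zpow_eq_zpow_two_mul h, ← h, ← pow_mul, ← pow_mul]
    congr 2
    · congr 1; ring
    · congr 2 <;> push_cast <;> ring
  · obtain ⟨M, rfl⟩ := Nat.not_even_iff_odd.1 hm
    rw [halfTerm_value_odd ht ht0 (by omega) h1, bOdd, show (2 * M + 1) / 2 = M by omega]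
    rw [show ∀ a b c : ℂ, a * (b / (2 * qInf q q)) * c = b / qInf q q / 2 * (a * c) by
      intros; field_simp]
    congr 1
    rw [mul_sum]
    refine sum_congr rfl fun k _ => ?_
    rw [mul_sum]
    refine sum_congr rfl fun l _ => ?_
    rw [← mul_sub, pow_succ t, mul_assoc (t ^ (2 * k + 2 * l)) t, ← mul_sub, ← h, ← pow_mul,
      ← pow_mul]
    rw [show 2 * (2 * (p + 2)) = 4 * (p + 2) by ring, show 2 * (k + l) = 2 * k + 2 * l by ring]
    have e1 : 2 * (2 * ((p + 2 : ℕ) : ℤ) - i - M + (2 * k + 2 * l : ℕ)) - 1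
        = 2 * (2 * (p + 2 : ℕ) - i - M + 2 * k + 2 * l) - 1 := by push_cast; ring
    have e2 : 2 * ((i : ℤ) + M - (2 * k + 2 * l : ℕ)) + 1
        = 2 * (i + M - 2 * k - 2 * l) + 1 := by push_cast; ring
    have e3 : 2 * (2 * ((p + 2 : ℕ) : ℤ) - i - M + (2 * k + 2 * l + 1 : ℕ)) - 1
        = 2 * (2 * (p + 2 : ℕ) - i - M + 2 * k + 2 * l) + 1 := by push_cast; ring
    have e4 : 2 * ((i : ℤ) + M - (2 * k + 2 * l + 1 : ℕ)) + 1
        = 2 * (i + M - 2 * k - 2 * l) - 1 := by push_cast; ring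
    rw [e1, e2, e3, e4]

theorem hasSum_termC_cVal (ht : ‖t‖ < 1) (ht0 : t ≠ 0) (h : t ^ 2 = q) (m : ℕ) {p i : ℕ}
    (hi : i ≤ p + 1) : HasSum (fun s => termC q t m (p + 2) i s) (cVal q t m (p + 2) i) := by
  obtain ⟨V, h1, h2⟩ := exists_hasSum_termC ht ht0 h m hi
  convert h2 using 1
  have h0 := qInf_self_ne_zero (norm_sq_lt_one ht h)
  unfold cVal
  split_ifs with hm
  · obtain ⟨M, rfl⟩ := hm.two_dvd
    rw [halfTerm_value ht ht0 (by omega) (one_mul _) h1, cEven, Nat.mul_div_cancel_left M two_pos]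
    rw [show qInf (-q ^ M) q / (2 * qInf q q) = qInf (-t ^ (2 * M)) q / qInf q q / 2 by
      rw [pow_mul, h]; field_simp]
    congr 1
    refine sum_congr rfl fun k _ => sum_congr rfl fun l _ => ?_
    rw [mul_assoc, zpow_eq_zpow_two_mul h, zpow_eq_zpow_two_mul h, ← h, ← pow_mul, ← pow_mul]
    congr 2
    · congr 1; ring
    · congr 2 <;> push_cast <;> ring
  · obtain ⟨M, rfl⟩ := Nat.not_even_iff_odd.1 hm
    rw [halfTerm_value_odd' ht ht0 (by omega) h1, cOdd, show (2 * M + 1) / 2 = M by omega]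
    rw [show ∀ a b c : ℂ, a * b * c = b * (a * c) by intros; ring]
    congr 1
    rw [mul_sum]
    refine sum_congr rfl fun l _ => ?_
    rw [← h, ← pow_mul, ← pow_mul]
    rw [show 2 * (2 * (p + 2)) = 4 * (p + 2) by ring]
    have e1 : ((2 * l : ℕ) : ℤ) = 2 * l := by push_cast; ring
    rw [e1]

/-- Append a zero to a sequence of nonnegative integers. -/
def DecSeq.snocZero {n : ℕ} (s : DecSeq n 0) : DecSeq (n + 1) (-((0 / 2 : ℕ) : ℤ)) :=
  DecSeq.mk' (fun j => if j ≤ n then s.entry j else 0)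
    (fun j k h1 hjk hk => by
      split_ifs with h2 h3 h3
      · exact s.entry_antitone h1 hjk h2
      · omega
      · exact s.le_entry h1 h3
      · exact le_rfl)
    fun j h1 _ => by
      split_ifs with h2
      · simpa using s.le_entry h1 h2
      · simp

theorem DecSeq.entry_snocZero {n : ℕ} (s : DecSeq n 0) {j : ℕ} (h1 : 1 ≤ j) (hj : j ≤ n) :
    s.snocZero.entry j = s.entry j := by
  rw [snocZero, entry_mk' _ _ _ h1 (by omega), if_pos hj]

theorem DecSeq.entry_snocZero_last {n : ℕ} (s : DecSeq n 0) :
    s.snocZero.entry (n + 1) = 0 := by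
  rw [snocZero, entry_mk' _ _ _ (by omega) le_rfl, if_neg (by omega)]

theorem termCor_add_two (q : ℂ) (p i : ℕ) (s : DecSeq (p + 1) 0) :
    termCor q (p + 2) i s
      = q ^ (s.entry 1 * (s.entry 1 + 1) / 2 + (∑ j ∈ Icc 2 (p + 1), s.entry j ^ 2)
          - ∑ j ∈ Icc 1 i, s.entry j) * qPoch (-1) q (s.entry 1)
        / ((∏ j ∈ Icc 1 p, qPoch q q (s.entry j - s.entry (j + 1)))
          * qPoch q q (s.entry (p + 1))) := rfl

theorem termC_snocZero (ht : ‖t‖ < 1) (ht0 : t ≠ 0) (h : t ^ 2 = q) {p i : ℕ} (hi : i ≤ p + 1)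
    (s : DecSeq (p + 1) 0) : termC q t 0 (p + 2) i s.snocZero = termCor q (p + 2) i s := by
  have hq := norm_sq_lt_one ht h
  have e0 : s.snocZero.entry (p + 2) = 0 := s.entry_snocZero_last
  have e1 : ∀ j, 1 ≤ j → j ≤ p + 1 → s.snocZero.entry j = s.entry j := fun j h1 hj =>
    s.entry_snocZero h1 hj
  have s1 : ∑ j ∈ Icc 1 i, s.snocZero.entry j = ∑ j ∈ Icc 1 i, s.entry j :=
    sum_congr rfl fun j hj => by rw [mem_Icc] at hj; exact e1 j hj.1 (by omega)
  have s2 : ∑ j ∈ Icc 2 (p + 2), s.snocZero.entry j ^ 2 = ∑ j ∈ Icc 2 (p + 1), s.entry j ^ 2 := by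
    rw [sum_Icc_succ_top (by omega), e0]
    simp only [ne_eq, OfNat.ofNat_ne_zero, not_false_eq_true, zero_pow, add_zero]
    exact sum_congr rfl fun j hj => by rw [mem_Icc] at hj; rw [e1 j (by omega) hj.2]
  have s3 : ∏ j ∈ Icc 1 (p + 1), qPoch q q (s.snocZero.entry j - s.snocZero.entry (j + 1))
      = (∏ j ∈ Icc 1 p, qPoch q q (s.entry j - s.entry (j + 1))) * qPoch q q (s.entry (p + 1)) := by
    rw [prod_Icc_succ_top (by omega), e0, e1 (p + 1) (by omega) le_rfl, sub_zero]
    congr 1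
    exact prod_congr rfl fun j hj => by
      rw [mem_Icc] at hj; rw [e1 j hj.1 (by omega), e1 (j + 1) (by omega) (by omega)]
  have hP : qPoch q q 0 = 1 := by
    have := rq_zero hq
    rwa [rq, inv_eq_one] at this
  have hb : qBinom q 0 0 = 1 := by simp [qBinom, hP]
  have e3 : t ^ (s.entry 1 ^ 2 + s.entry 1) = q ^ (s.entry 1 * (s.entry 1 + 1) / 2) := by
    rw [zpow_eq_zpow_two_mul h, Int.mul_ediv_cancel' (Int.even_mul_succ_self _).two_dvd]
    congr 1; ring
  rw [termC, termCor_add_two, show p + 2 - 1 = p + 1 from rfl, s1, s2, s3, e0,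
    e1 1 le_rfl (by omega)]
  simp only [Nat.cast_zero, zero_mul, add_zero, pow_zero, mul_zero, zpow_zero, hb, mul_one,
    Int.zero_ediv]
  rw [e3, ← zpow_add₀ (sq_ne_zero_of_eq ht0 h), ← add_sub_assoc]

theorem hasSum_termCor_of_ne_zero (hq : ‖q‖ < 1) (hq0 : q ≠ 0) {p i : ℕ} (hi : i ≤ p + 1) :
    HasSum (fun s : DecSeq (p + 1) 0 => termCor q (p + 2) i s)
      (qInf (-q) q / qInf q q
        * ∑ k ∈ range (2 * i + 1),
            qInf3 (q ^ (2 * (p + 2))) (q ^ ((p + 2 : ℕ) - i + k : ℤ)) (q ^ ((p + 2 : ℕ) + i - k : ℤ))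
              (q ^ (2 * (p + 2)))) := by
  obtain ⟨t, h⟩ := IsAlgClosed.exists_pow_nat_eq q two_pos
  have ht0 : t ≠ 0 := by rintro rfl; exact hq0 (by simpa using h.symm)
  have ht : ‖t‖ < 1 := by
    rw [← h, norm_pow] at hq
    exact (pow_lt_one_iff_of_nonneg (norm_nonneg _) two_ne_zero).1 hq
  have key := hasSum_termC_cVal ht ht0 h 0 hi
  have hinj : Function.Injective (DecSeq.snocZero (n := p + 1)) := fun s s' hs =>
    DecSeq.ext_entry fun j h1 hj => by
      rw [← s.entry_snocZero h1 hj, hs, s'.entry_snocZero h1 hj]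
  rw [← hinj.hasSum_iff] at key
  · convert key using 1
    · funext s
      exact (termC_snocZero ht ht0 h hi s).symm
    · rw [cVal, if_pos (by simp), cEven]
      -- The first factor of (-1)_∞ is 2, which cancels the 1/2 in `cEven`.
      have e : qInf (-1) q = 2 * qInf (-q) q := by rw [qInf_eq_mul hq]; norm_num
      simp only [Nat.zero_div, pow_zero, mul_zero, zero_add, range_one, sum_singleton, one_mul,
        zero_mul, Nat.cast_zero, sub_zero, add_zero]
      rw [e, mul_div_mul_left _ _ two_ne_zero]
  · intro s hs
    have hlo : 0 ≤ s.entry (p + 2) := by simpa using s.le_entry (j := p + 2) (by omega) le_rfl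
    have hne : s.entry (p + 2) ≠ 0 := fun h0 => hs ⟨DecSeq.mk' s.entry
      (fun j k h1 hjk hk => s.entry_antitone h1 hjk (by omega))
      (fun j h1 hj => by simpa using s.le_entry h1 (by omega)), DecSeq.ext_entry fun j h1 hj => by
        rcases Nat.lt_or_ge (p + 1) j with hj' | hj'
        · obtain rfl : j = p + 2 := by omega
          rw [h0]; exact DecSeq.entry_snocZero_last _
        · rw [DecSeq.entry_snocZero _ h1 hj', DecSeq.entry_mk' _ _ _ h1 hj']⟩
    -- For s_r > 0 the lower index 2s_r exceeds the upper index s_r, so only sequences ending in 0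
    -- contribute.
    have : qBinom q ((0 : ℕ) + s.entry (p + 2)) ((0 : ℕ) + 2 * s.entry (p + 2)) = 0 := by
      rw [qBinom, if_neg]
      push_cast; omega
    rw [termC, this, mul_zero]

end Values

/-! ### The last identity at q = 0 -/

section ZeroBase

theorem qInf_base_zero (a : ℂ) : qInf a 0 = 1 - a := by
  have h0 : qInf 0 (0 : ℂ) = 1 := by simp [qInf]
  rw [qInf_eq_mul (by simp), mul_zero, h0, mul_one]

theorem qPoch_zero_zero (k : ℤ) : qPoch 0 0 k = 1 := by simp [qPoch, qInf_base_zero]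

theorem qPoch_neg_one_zero (k : ℤ) : qPoch (-1) 0 k = if k = 0 then 1 else 2 := by
  rw [qPoch, qInf_base_zero, qInf_base_zero]
  split_ifs with hk
  · simp [hk]
  · rw [zero_zpow k hk]; norm_num

/-- The exponent of `q` in `termCor`, variable by variable. -/
def corExp (i j : ℕ) (x : ℤ) : ℤ :=
  (if j = 1 then x * (x + 1) / 2 else x ^ 2) - if j ≤ i then x else 0

theorem termCor_zero {p i : ℕ} (hi : i ≤ p + 1) (s : DecSeq (p + 1) 0) :
    termCor 0 (p + 2) i s = 0 ^ (∑ j ∈ Icc 1 (p + 1), corExp i j (s.entry j)) *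
      if s.entry 1 = 0 then 1 else 2 := by
  have hI : Icc 1 (p + 1) = insert 1 (Icc 2 (p + 1)) := by
    ext j; simp only [mem_insert, mem_Icc]; omega
  have hf : (Icc 1 (p + 1)).filter (· ≤ i) = Icc 1 i := by
    ext j; simp only [mem_filter, mem_Icc]; omega
  have e : ∑ j ∈ Icc 1 (p + 1), corExp i j (s.entry j)
      = s.entry 1 * (s.entry 1 + 1) / 2 + ∑ j ∈ Icc 2 (p + 1), s.entry j ^ 2
        - ∑ j ∈ Icc 1 i, s.entry j := by
    simp only [corExp]
    rw [sum_sub_distrib, ← sum_filter, hf, hI, sum_insert (by simp), if_pos rfl]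
    congr 2
    exact sum_congr rfl fun j hj => by rw [mem_Icc] at hj; rw [if_neg (by omega)]
  rw [termCor_add_two, e, qPoch_neg_one_zero]
  simp [qPoch_zero_zero]

theorem corExp_nonneg {i j : ℕ} {x : ℤ} (hx : 0 ≤ x) : 0 ≤ corExp i j x := by
  have h1 : x ≤ x ^ 2 := by nlinarith [mul_nonneg hx hx, Int.le_self_sq x]
  have h2 : x ≤ x * (x + 1) / 2 := by
    rw [Int.le_ediv_iff_mul_le two_pos]; nlinarith
  unfold corExp
  split_ifs <;> linarith

/-- At q = 0 a term survives only if its total exponent is 0; as all contributions are nonnegative,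
each must vanish. -/
theorem corExp_eq_zero_iff {i j : ℕ} {x : ℤ} (hx : 0 ≤ x) :
    corExp i j x = 0 ↔ x = 0 ∨ x = 1 ∧ j ≤ i := by
  have h0 : x * (x + 1) / 2 * 2 = x * (x + 1) :=
    Int.ediv_mul_cancel (Int.even_mul_succ_self _).two_dvd
  unfold corExp
  generalize x * (x + 1) / 2 = z at h0
  constructor
  · intro h
    have h2 : x * (x - 1) = 0 ∨ x = 0 := by
      split_ifs at h
      · left; nlinarith
      · right; nlinarith
      · left; nlinarith
      · right; nlinarith
    have h3 : x = 0 ∨ x = 1 := by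
      rcases h2 with h2 | h2
      · rcases mul_eq_zero.1 h2 with h3 | h3 <;> omega
      · exact Or.inl h2
    rcases h3 with rfl | rfl
    · exact Or.inl rfl
    · refine Or.inr ⟨rfl, ?_⟩
      by_contra hc
      rw [if_neg hc] at h
      split_ifs at h <;> omega
  · rintro (rfl | ⟨rfl, hj⟩)
    · split_ifs <;> omega
    · rw [if_pos hj]; split_ifs <;> omega

/-- The sequence `1, …, 1, 0, …, 0` with `a` ones. -/
def stepSeq (n a : ℕ) : DecSeq n 0 :=
  DecSeq.mk' (fun j => if j ≤ a then 1 else 0) (fun j k _ hjk _ => by split_ifs <;> omega)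
    fun j _ _ => by split_ifs <;> omega

/-- The surviving sequences consist of a ones followed by zeros, 0 ≤ a ≤ i. The value is 1 for a = 0
and (-1)_1 = 2 otherwise, in total 2i + 1. -/
theorem hasSum_termCor_zero {p i : ℕ} (hi : i ≤ p + 1) :
    HasSum (fun s : DecSeq (p + 1) 0 => termCor 0 (p + 2) i s) (2 * i + 1) := by
  have hent : ∀ a j, 1 ≤ j → j ≤ p + 1 → (stepSeq (p + 1) a).entry j = if j ≤ a then 1 else 0 :=
    fun a j h1 hj => DecSeq.entry_mk' _ _ _ h1 hj
  have hinj : Function.Injective fun a : Fin (i + 1) => stepSeq (p + 1) a := by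
    intro a b hab
    by_contra hne
    wlog hlt : a < b generalizing a b
    · exact this hab.symm (Ne.symm hne) (lt_of_le_of_ne (not_lt.1 hlt) (Ne.symm hne))
    have h1 := congrArg (fun s => s.entry b) hab
    have hb := b.2
    have hlt' : (a : ℕ) < b := hlt
    simp only [hent _ _ (by omega : 1 ≤ (b : ℕ)) (by omega : (b : ℕ) ≤ p + 1)] at h1
    rw [if_neg (by omega), if_pos le_rfl] at h1
    exact absurd h1 (by norm_num)
  rw [← hinj.hasSum_iff]
  · have hval : ∀ a : Fin (i + 1), termCor 0 (p + 2) i (stepSeq (p + 1) a)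
        = if (a : ℕ) = 0 then 1 else 2 := fun a => by
      have ha := a.2
      rw [termCor_zero hi, sum_eq_zero fun j hj => ?_, zpow_zero, one_mul,
        hent _ 1 le_rfl (by omega)]
      · rcases Nat.eq_zero_or_pos (a : ℕ) with h0 | h0
        · simp [h0]
        · rw [if_pos (by omega : 1 ≤ (a : ℕ)), if_neg one_ne_zero, if_neg (by omega)]
      · rw [mem_Icc] at hj
        rw [hent _ j hj.1 hj.2, corExp_eq_zero_iff (by split_ifs <;> omega)]
        split_ifs with hc
        · exact Or.inr ⟨rfl, by omega⟩
        · exact Or.inl rfl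
    convert hasSum_fintype _ using 1
    simp only [Function.comp, hval]
    rw [Fin.sum_univ_succ]
    simp [mul_comm]
    ring
  · intro s hs
    rw [termCor_zero hi, zero_zpow, zero_mul]
    intro h0
    have hnn : ∀ j ∈ Icc 1 (p + 1), 0 ≤ s.entry j := fun j hj => by
      rw [mem_Icc] at hj; exact s.le_entry hj.1 hj.2
    have h1 := (sum_eq_zero_iff_of_nonneg fun j hj => corExp_nonneg (hnn j hj)).1 h0
    have h2 : ∀ j, 1 ≤ j → j ≤ p + 1 → s.entry j = 0 ∨ s.entry j = 1 ∧ j ≤ i := fun j h3 h4 =>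
      (corExp_eq_zero_iff (hnn j (mem_Icc.2 ⟨h3, h4⟩))).1 (h1 j (mem_Icc.2 ⟨h3, h4⟩))
    classical
    -- The number of ones is the last index at most i whose entry is 1; monotonicity fills in the
    -- ones before it.
    set a := Nat.findGreatest (fun j => 1 ≤ j ∧ s.entry j = 1) i with ha
    have hai : a ≤ i := Nat.findGreatest_le i
    refine hs ⟨⟨a, by omega⟩, DecSeq.ext_entry fun j h3 h4 => ?_⟩
    rw [hent _ j h3 h4]
    change (if j ≤ a then 1 else 0) = _
    split_ifs with hc
    · have h5 : 1 ≤ a ∧ s.entry a = 1 := Nat.findGreatest_of_ne_zero ha.symm (by omega)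
      have h6 := s.entry_antitone h3 hc (by omega)
      rcases h2 j h3 h4 with h7 | h7 <;> omega
    · rcases h2 j h3 h4 with h7 | h7
      · exact h7.symm
      · exact absurd ⟨h3, h7.1⟩ (Nat.findGreatest_is_greatest (not_le.1 hc) h7.2)

/-- Since i ≤ r - 1 and k ≤ 2i, all exponents of 0 are positive and each triple product is 1. -/
theorem qInf_neg_zero_div_mul_sum (p i : ℕ) (hi : i ≤ p + 1) :
    (qInf (-0) 0 / qInf 0 0
      * ∑ k ∈ range (2 * i + 1),
          qInf3 (0 ^ (2 * (p + 2))) (0 ^ ((p + 2 : ℕ) - i + k : ℤ)) (0 ^ ((p + 2 : ℕ) + i - k : ℤ))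
            (0 ^ (2 * (p + 2)))) = (2 * i + 1 : ℂ) := by
  rw [sum_congr (g := fun _ => 1) rfl fun k hk => ?_]
  · rw [sum_const]; simp [qInf_base_zero]
  · rw [mem_range] at hk
    rw [zero_zpow _ (by omega), zero_zpow _ (by omega), zero_pow (by omega)]
    simp [qInf3, qInf_base_zero]

end ZeroBase

theorem mainTheorem11 (r i : ℕ) (hr : 2 ≤ r) (hi : i ≤ r - 1) (q : ℂ) (hq : ‖q‖ < 1) :
    (∀ t : ℂ, t ^ 2 = q → q ≠ 0 → ∀ m : ℕ,
      HasSum (fun s => termB q t m r i s) (bVal q t m r i) ∧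
      HasSum (fun s => termC q t m r i s) (cVal q t m r i)) ∧
    HasSum (fun s => termCor q r i s)
      (qInf (-q) q / qInf q q
        * ∑ k ∈ Finset.range (2 * i + 1),
            qInf3 (q ^ (2 * r)) (q ^ (r - i + k : ℤ)) (q ^ (r + i - k : ℤ)) (q ^ (2 * r))) := by
  obtain ⟨p, rfl⟩ : ∃ p, r = p + 2 := ⟨r - 2, by omega⟩
  have hi' : i ≤ p + 1 := hi
  refine ⟨fun t h hq0 m => ?_, ?_⟩
  · have ht0 : t ≠ 0 := by rintro rfl; exact hq0 (by simpa using h.symm)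
    have ht : ‖t‖ < 1 := by
      rw [← h, norm_pow] at hq
      exact (pow_lt_one_iff_of_nonneg (norm_nonneg _) two_ne_zero).1 hq
    exact ⟨hasSum_termB_bVal ht ht0 h m hi', hasSum_termC_cVal ht ht0 h m hi'⟩
  · rcases eq_or_ne q 0 with rfl | hq0
    · rw [qInf_neg_zero_div_mul_sum p i hi']
      exact hasSum_termCor_zero hi'
    · exact hasSum_termCor_of_ne_zero hq hq0 hi'
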